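/- For $n\in\mathbb{N}$, let $\mathbb{H}^n$ denote the real vector space of $n\times n$ complex Hermitian matrices. A set $\mathcal{A}\subseteq\mathbb{H}^n$ is called - *singular* if its real linear span contains no invertible matrix; - *simultaneously diagonalizable via congruence* (SDC) if there is an invertible $P\in\mathbb{C}^{n\times n}$ such that $P^*AP$ is diagonal for all $A\in\mathcal{A}$; - *almost simultaneously diagonalizable via congruence* (ASDC) if there is a mapping $f:\mathcal{A}\times\mathbb{N}\to\mathbb{H}^n$ such that $\lim_{j\to\infty}f(A,j)=A$ for every $A\in\mathcal{A}$, and for every $j\in\mathbb{N}$ the set $\{f(A,j):A\in\mathcal{A}\}$ is SDC. **Theorem.** Let $A,B\in\mathbb{H}^n$. If $\{A,B\}$ is singular, then $\{A,B\}$ is ASDC. -/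

import Mathlib

open Filter Topology
open scoped Matrix

/-- The real vector space of `n × n` complex Hermitian matrices, with the topology inherited from
`Matrix (Fin n) (Fin n) ℂ` (entrywise convergence, i.e. convergence in any norm). -/
abbrev HermMat (n : ℕ) : Type :=
  selfAdjoint (Matrix (Fin n) (Fin n) ℂ)

/-- A set of Hermitian matrices is *simultaneously diagonalizable via congruence* (SDC) if there
is an invertible complex matrix `P` such that `Pᴴ * A * P` is diagonal for every `A` in the set. -/
def IsSDC {n : ℕ} (𝒜 : Set (HermMat n)) : Prop :=
  ∃ P : Matrix (Fin n) (Fin n) ℂ, IsUnit P ∧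
    ∀ A ∈ 𝒜, (Pᴴ * (A : Matrix (Fin n) (Fin n) ℂ) * P).IsDiag

/-- A set `𝒜` of Hermitian matrices is *almost simultaneously diagonalizable via congruence* (ASDC)
if there is a mapping `f : 𝒜 × ℕ → HermMat n` such that `f (A, j) → A` as `j → ∞` for every `A ∈ 𝒜`,
and `{f (A, j) : A ∈ 𝒜}` is SDC for every `j`. -/
def IsASDC {n : ℕ} (𝒜 : Set (HermMat n)) : Prop :=
  ∃ f : 𝒜 × ℕ → HermMat n,
    (∀ A : 𝒜, Tendsto (fun j : ℕ => f (A, j)) atTop (𝓝 (A : HermMat n))) ∧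
    ∀ j : ℕ, IsSDC {M : HermMat n | ∃ A : 𝒜, f (A, j) = M}

/-- A set of Hermitian matrices is *nonsingular* if its real span contains an invertible matrix. -/
def IsNonsingularSet {n : ℕ} (𝒜 : Set (HermMat n)) : Prop :=
  ∃ A ∈ Submodule.span ℝ 𝒜, IsUnit (A : Matrix (Fin n) (Fin n) ℂ)

/-- A set of Hermitian matrices is *singular* if it is not nonsingular. -/
def IsSingularSet {n : ℕ} (𝒜 : Set (HermMat n)) : Prop :=
  ¬ IsNonsingularSet 𝒜

/-!
A pair of Hermitian matrices `(A, B)` is diagonalized by one congruence as soon as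
`det (A + t • B)` has as many distinct real roots as its size and is not identically zero: the
kernel vectors at the roots are orthogonal for both forms and form a basis
(`isSDCPair_of_real_roots`). Since simple real roots are sign changes, this criterion is open among
Hermitian pairs (`eventually_isSDCPair`).

If `det (A + t • B)` vanishes identically, the pencil has a polynomial kernel vector, and one of
minimal degree `e` gives a basis in which the pencil is
`[[0, M t, 0], [M tᴴ, N t, K t], [0, K tᴴ, R t]]`, where `M t` is an `(e + 1) × e` pencil whose
transpose annihilates `(1, t, …, t ^ e)` (`exists_singular_normal_form`). The zero blocks leave room
for the perturbation `[[s² E t, M t, s a], [M tᴴ, N t, K t], [s aᴴ, K tᴴ, R t]]`. Scaling the three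
blocks by `s⁻¹`, `s` and `1`, this is congruent to
`[[E t, M t, a], [M tᴴ, s² N t, s K t], [aᴴ, s K tᴴ, R t]]`, whose limit as `s → 0` no longer
involves `N` and `K`, while `E` and `a` are arbitrary. The limit is singular at `t` exactly when
`q t = bᴴ (R t)⁻¹ b` (`det_hermBlock_shift_eq_zero_iff`), where `q` is a real polynomial of degree
at most `2 e + 1`, prescribed through `E`, and the vector `b` is prescribed through `a`.

It remains to choose `q` and `b` so that this equation has `n` distinct real solutions
(`exists_real_rooted_schur_complement`). A small perturbation of `R` makes the roots of `det R`
distinct (`exists_isGenericPencil_mem_nhds`); let `χ` be the monic polynomial with these roots.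
Division by `χ` writes any real polynomial `f` of degree `n` as `χ` times the sum of a polynomial
`q` and simple poles, and this sum of poles is `-bᴴ (R t)⁻¹ b` for some `b`, provided `f` has
certain signs at the real roots of `det R`. There are fewer than `n` of these roots, so the signs
are attained by some `f` with `n` distinct real roots (`exists_roots_with_signs`).
-/

/-! ### Pencils with enough real roots -/

/-- A pair of Hermitian matrices, over an arbitrary finite index type, that a single congruence
makes diagonal. -/
def IsSDCPair {ι : Type*} [Fintype ι] [DecidableEq ι] (X : Matrix ι ι ℂ × Matrix ι ι ℂ) : Prop :=
  X.1.IsHermitian ∧ X.2.IsHermitian ∧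
    ∃ P : Matrix ι ι ℂ, IsUnit P ∧ (Pᴴ * X.1 * P).IsDiag ∧ (Pᴴ * X.2 * P).IsDiag

theorem conjTranspose_mul_mul_apply {ι κ μ : Type*} [Fintype ι] (P : Matrix ι κ ℂ)
    (A : Matrix ι ι ℂ) (Q : Matrix ι μ ℂ) (i : κ) (j : μ) :
    (Pᴴ * A * Q) i j = star (fun k => P k i) ⬝ᵥ A *ᵥ (fun k => Q k j) := by
  rw [Matrix.mul_assoc, Matrix.mul_apply']
  congr 1

theorem Matrix.IsHermitian.star_mulVec_dotProduct {ι : Type*} [Fintype ι] {A : Matrix ι ι ℂ}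
    (hA : A.IsHermitian) (x y : ι → ℂ) : star (A *ᵥ x) ⬝ᵥ y = star x ⬝ᵥ A *ᵥ y := by
  rw [Matrix.star_mulVec, hA.eq, Matrix.dotProduct_mulVec]

theorem Matrix.IsHermitian.real_smul {ι : Type*} {A : Matrix ι ι ℂ} (hA : A.IsHermitian) (t : ℝ) :
    ((t : ℂ) • A).IsHermitian := by
  rw [Matrix.IsHermitian, Matrix.conjTranspose_smul, hA.eq]
  simp

theorem Matrix.IsHermitian.add_real_smul {ι : Type*} {A B : Matrix ι ι ℂ} (hA : A.IsHermitian)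
    (hB : B.IsHermitian) (t : ℝ) : (A + (t : ℂ) • B).IsHermitian :=
  hA.add (hB.real_smul t)

section RealRoots

variable {ι : Type*} [Fintype ι] [DecidableEq ι]

/-- Kernel vectors of `A + t i • B` for distinct real `t i` are orthogonal for both forms, and they
are eigenvectors of `(A + τ • B)⁻¹ * B` for distinct eigenvalues, hence a basis. -/
theorem isSDCPair_of_real_roots {A B : Matrix ι ι ℂ} (hA : A.IsHermitian) (hB : B.IsHermitian)
    (t : ι → ℝ) (ht : Function.Injective t) (hdet : ∀ i, (A + (t i : ℂ) • B).det = 0)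
    (τ : ℝ) (hτ : (A + (τ : ℂ) • B).det ≠ 0) : IsSDCPair (A, B) := by
  have hne : ∀ i, (τ : ℂ) - t i ≠ 0 := by
    intro i h
    apply hτ
    rw [sub_eq_zero.mp h]
    exact hdet i
  choose x hx0 hx using fun i => Matrix.exists_mulVec_eq_zero_iff.mpr (hdet i)
  have hx' : ∀ i, A *ᵥ x i = -((t i : ℂ) • B *ᵥ x i) := by
    intro i
    have := hx i
    rw [Matrix.add_mulVec, Matrix.smul_mulVec] at this
    exact eq_neg_of_add_eq_zero_left this
  set G := A + (τ : ℂ) • B with hG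
  have hGx : ∀ i, G *ᵥ x i = ((τ : ℂ) - t i) • B *ᵥ x i := by
    intro i
    rw [hG, Matrix.add_mulVec, Matrix.smul_mulVec, hx' i, sub_smul]
    abel
  have hGu : IsUnit G.det := isUnit_iff_ne_zero.mpr hτ
  have hBx : ∀ i, (G⁻¹ * B) *ᵥ x i = ((τ : ℂ) - t i)⁻¹ • x i := by
    intro i
    have h1 : B *ᵥ x i = ((τ : ℂ) - t i)⁻¹ • G *ᵥ x i := by
      rw [hGx, smul_smul, inv_mul_cancel₀ (hne i), one_smul]
    rw [← Matrix.mulVec_mulVec, h1, Matrix.mulVec_smul, Matrix.mulVec_mulVec,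
      Matrix.nonsing_inv_mul _ hGu, Matrix.one_mulVec]
  have hli : LinearIndependent ℂ x := by
    refine Module.End.eigenvectors_linearIndependent' (Matrix.toLin' (G⁻¹ * B))
      (fun i => ((τ : ℂ) - t i)⁻¹) ?_ x ?_
    · intro i j hij
      have h := inv_injective hij
      apply ht
      have h2 : (t i : ℂ) = t j := sub_right_injective h
      exact_mod_cast h2
    · intro i
      rw [Module.End.hasEigenvector_iff, Module.End.mem_eigenspace_iff]
      exact ⟨by simpa [Matrix.toLin'_apply] using hBx i, hx0 i⟩
  have horth : ∀ i j, i ≠ j → star (x i) ⬝ᵥ B *ᵥ x j = 0 ∧ star (x i) ⬝ᵥ A *ᵥ x j = 0 := by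
    intro i j hij
    have h1 : star (x i) ⬝ᵥ A *ᵥ x j = -(t j * star (x i) ⬝ᵥ B *ᵥ x j) := by
      rw [hx' j, dotProduct_neg, dotProduct_smul, smul_eq_mul]
    have h2 : star (x i) ⬝ᵥ A *ᵥ x j = -(t i * star (x i) ⬝ᵥ B *ᵥ x j) := by
      rw [← hA.star_mulVec_dotProduct, hx' i, star_neg, star_smul, neg_dotProduct, smul_dotProduct,
        hB.star_mulVec_dotProduct]
      simp
    have h3 : ((t i : ℂ) - t j) * star (x i) ⬝ᵥ B *ᵥ x j = 0 := by linear_combination h2 - h1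
    have h4 : (t i : ℂ) - t j ≠ 0 := by
      rw [sub_ne_zero]
      exact_mod_cast ht.ne hij
    have h5 := (mul_eq_zero.mp h3).resolve_left h4
    exact ⟨h5, by rw [h1, h5]; simp⟩
  refine ⟨hA, hB, Matrix.of (fun k i => x i k), ?_, ?_, ?_⟩
  · rw [← Matrix.linearIndependent_cols_iff_isUnit]
    exact hli
  · intro i j hij
    rw [conjTranspose_mul_mul_apply]
    exact (horth i j hij).2
  · intro i j hij
    rw [conjTranspose_mul_mul_apply]
    exact (horth i j hij).1

theorem det_im_eq_zero {A : Matrix ι ι ℂ} (hA : A.IsHermitian) : A.det.im = 0 := by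
  have h : star A.det = A.det := by
    rw [← Matrix.det_conjTranspose, hA.eq]
  exact Complex.conj_eq_iff_im.mp h

theorem eval_det_pencil (A B : Matrix ι ι ℂ) (t : ℂ) :
    ((Polynomial.X : Polynomial ℂ) • B.map Polynomial.C + A.map Polynomial.C).det.eval t =
      (A + t • B).det := by
  rw [← Polynomial.coe_evalRingHom, RingHom.map_det]
  congr 1
  ext i j
  simp [add_comm, mul_comm (B i j)]

/-- A pencil whose determinant has the largest possible number of distinct roots factors
completely. -/
theorem det_pencil_eq_mul_prod (A B : Matrix ι ι ℂ) {κ : Type*} [Fintype κ]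
    (hκ : Fintype.card κ = Fintype.card ι) {l : κ → ℂ} (hl : Function.Injective l)
    (hdet : ∀ k, (A + l k • B).det = 0) (t : ℂ) :
    (A + t • B).det = B.det * ∏ k, (t - l k) := by
  classical
  set g : Polynomial ℂ :=
    ((Polynomial.X : Polynomial ℂ) • B.map Polynomial.C + A.map Polynomial.C).det with hg
  have heval : ∀ t : ℂ, g.eval t = (A + t • B).det := eval_det_pencil A B
  have hdeg : g.natDegree ≤ Fintype.card ι := Polynomial.natDegree_det_X_add_C_le B A
  have hcoeff : g.coeff (Fintype.card ι) = B.det := Polynomial.coeff_det_X_add_C_card B A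
  set h : Polynomial ℂ := ∏ k, (Polynomial.X - Polynomial.C (l k)) with hh
  have hmonic : h.Monic := Polynomial.monic_prod_of_monic _ _ fun k _ => Polynomial.monic_X_sub_C _
  have hhdeg : h.natDegree = Fintype.card ι := by
    rw [hh, Polynomial.natDegree_prod_of_monic _ _ fun k _ => Polynomial.monic_X_sub_C _]
    simp [hκ]
  have hdvd : h ∣ g := by
    refine Finset.prod_dvd_of_coprime ?_ ?_
    · intro a _ b _ hab
      refine Polynomial.isCoprime_X_sub_C_of_isUnit_sub ?_
      rw [isUnit_iff_ne_zero, sub_ne_zero]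
      exact hl.ne hab
    · intro k _
      rw [Polynomial.dvd_iff_isRoot, Polynomial.IsRoot, heval]
      exact hdet k
  obtain ⟨q, hq⟩ := hdvd
  have hqdeg : q.natDegree = 0 := by
    by_cases hq0 : q = 0
    · simp [hq0]
    · have := hmonic.natDegree_mul' hq0
      rw [← hq] at this
      omega
  rw [Polynomial.natDegree_eq_zero] at hqdeg
  obtain ⟨c, rfl⟩ := hqdeg
  have hc : c = B.det := by
    rw [← hcoeff, hq, Polynomial.coeff_mul_C, ← hhdeg, hmonic.coeff_natDegree, one_mul]
  rw [← heval, hq, hh, Polynomial.eval_mul, Polynomial.eval_prod, mul_comm, hc]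
  simp

/-- Simple real roots are stable: the determinant of a Hermitian pencil is real on the real line,
changes sign at each of its simple roots, and continues to do so after a small perturbation. -/
theorem eventually_isSDCPair {L : Matrix ι ι ℂ × Matrix ι ι ℂ} (hA : L.1.IsHermitian)
    (hB : L.2.IsHermitian) (Z : Finset ℝ) (hZ : Z.card = Fintype.card ι)
    (hdet : ∀ z ∈ Z, (L.1 + (z : ℂ) • L.2).det = 0) (t₀ : ℝ)
    (ht₀ : (L.1 + (t₀ : ℂ) • L.2).det ≠ 0) :
    ∀ᶠ X in 𝓝 L, X.1.IsHermitian → X.2.IsHermitian → IsSDCPair X := by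
  set c := L.2.det
  have hc : ∀ t : ℂ, (L.1 + t • L.2).det = c * ∏ z ∈ Z, (t - z) := by
    intro t
    rw [det_pencil_eq_mul_prod L.1 L.2 (l := fun z : Z => ((z : ℝ) : ℂ)) (by simp [hZ])
      (Complex.ofReal_injective.comp Subtype.val_injective) (fun z => hdet z z.2) t,
      Finset.prod_coe_sort Z fun z => t - (z : ℂ)]
  have hreal : ∀ t : ℝ, (L.1 + (t : ℂ) • L.2).det.re = c.re * ∏ z ∈ Z, (t - z) := by
    intro t
    have : (∏ z ∈ Z, ((t : ℂ) - z)) = ((∏ z ∈ Z, (t - z) : ℝ) : ℂ) := by push_cast; rfl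
    rw [hc, this, Complex.re_mul_ofReal]
  have hcre : c.re ≠ 0 := by
    intro h
    apply ht₀
    apply Complex.ext
    · rw [hreal, h]; simp
    · exact det_im_eq_zero (hA.add_real_smul hB t₀)
  -- A radius less than the distance between any two roots isolates each sign change.
  obtain ⟨δ, hδ, hsep⟩ : ∃ δ : ℝ, 0 < δ ∧ ∀ a ∈ Z, ∀ b ∈ Z, a ≠ b → 2 * δ < |a - b| := by
    have : ∀ᶠ δ : ℝ in 𝓝[>] 0, ∀ a ∈ Z, ∀ b ∈ Z, a ≠ b → 2 * δ < |a - b| := by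
      rw [eventually_all_finset]
      intro a _
      rw [eventually_all_finset]
      intro b _
      by_cases hab : a = b
      · simp [hab]
      · have hlt : 0 < |a - b| / 2 := by
          have := abs_pos.mpr (sub_ne_zero.mpr hab)
          positivity
        filter_upwards [nhdsWithin_le_nhds (Iio_mem_nhds hlt)] with δ hδ _
        simp only [Set.mem_Iio] at hδ
        linarith
    obtain ⟨δ, h1, h2⟩ := (this.and self_mem_nhdsWithin).exists
    exact ⟨δ, h2, h1⟩
  have hsign : ∀ z ∈ Z, (L.1 + ((z - δ : ℝ) : ℂ) • L.2).det.re *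
      (L.1 + ((z + δ : ℝ) : ℂ) • L.2).det.re < 0 := by
    intro z hz
    rw [hreal, hreal]
    have h1 : c.re * (∏ x ∈ Z, (z - δ - x)) * (c.re * ∏ x ∈ Z, (z + δ - x)) =
        c.re ^ 2 * ∏ x ∈ Z, ((z - x) ^ 2 - δ ^ 2) := by
      rw [show ∀ a b : ℝ, c.re * a * (c.re * b) = c.re ^ 2 * (a * b) by intros; ring,
        ← Finset.prod_mul_distrib]
      congr 1
      refine Finset.prod_congr rfl fun x _ => ?_
      ring
    rw [h1, ← Finset.mul_prod_erase _ _ hz]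
    have h2 : 0 < ∏ x ∈ Z.erase z, ((z - x) ^ 2 - δ ^ 2) := by
      refine Finset.prod_pos fun x hx => ?_
      obtain ⟨hxz, hx⟩ := Finset.mem_erase.mp hx
      have h3 := hsep z hz x hx hxz.symm
      rw [sub_pos, ← sq_abs (z - x)]
      nlinarith
    have h4 : 0 < c.re ^ 2 := by positivity
    have h5 : 0 < δ ^ 2 * (c.re ^ 2 * ∏ x ∈ Z.erase z, ((z - x) ^ 2 - δ ^ 2)) := by positivity
    nlinarith
  have hcont : ∀ t : ℝ, Continuous fun X : Matrix ι ι ℂ × Matrix ι ι ℂ =>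
      (X.1 + (t : ℂ) • X.2).det := by
    intro t
    exact Continuous.matrix_det (by fun_prop)
  have hev1 : ∀ᶠ X in 𝓝 L, ∀ z ∈ Z, (X.1 + ((z - δ : ℝ) : ℂ) • X.2).det.re *
      (X.1 + ((z + δ : ℝ) : ℂ) • X.2).det.re < 0 := by
    rw [eventually_all_finset]
    intro z hz
    have : Continuous fun X : Matrix ι ι ℂ × Matrix ι ι ℂ =>
        (X.1 + ((z - δ : ℝ) : ℂ) • X.2).det.re * (X.1 + ((z + δ : ℝ) : ℂ) • X.2).det.re :=
      (Complex.continuous_re.comp (hcont _)).mul (Complex.continuous_re.comp (hcont _))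
    exact this.continuousAt.eventually_lt continuousAt_const (hsign z hz)
  have hev2 : ∀ᶠ X in 𝓝 L, (X.1 + (t₀ : ℂ) • X.2).det ≠ 0 :=
    (hcont t₀).continuousAt.eventually_ne ht₀
  filter_upwards [hev1, hev2] with X hX hX0 hXA hXB
  have hroot : ∀ z : Z, ∃ t : ℝ, t ∈ Set.Icc (z.1 - δ) (z.1 + δ) ∧
      (X.1 + (t : ℂ) • X.2).det = 0 := by
    rintro ⟨z, hz⟩
    have hf : Continuous fun t : ℝ => (X.1 + (t : ℂ) • X.2).det.re := by
      refine Complex.continuous_re.comp (Continuous.matrix_det ?_)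
      fun_prop
    have hle : z - δ ≤ z + δ := by linarith
    have h0 : ∃ t ∈ Set.Icc (z - δ) (z + δ), (X.1 + (t : ℂ) • X.2).det.re = 0 := by
      rcases mul_neg_iff.mp (hX z hz) with ⟨h1, h2⟩ | ⟨h1, h2⟩
      · exact intermediate_value_Icc' hle hf.continuousOn ⟨h2.le, h1.le⟩
      · exact intermediate_value_Icc hle hf.continuousOn ⟨h1.le, h2.le⟩
    obtain ⟨t, ht, ht0⟩ := h0
    exact ⟨t, ht, Complex.ext ht0 (det_im_eq_zero (hXA.add_real_smul hXB t))⟩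
  choose r hr hr0 using hroot
  have hrinj : Function.Injective r := by
    intro a b hab
    by_contra hne
    have h1 := hsep a a.2 b b.2 (fun h => hne (Subtype.ext h))
    have h2 := hr a
    have h3 := hr b
    rw [hab] at h2
    rw [Set.mem_Icc] at h2 h3
    have : |(a : ℝ) - b| ≤ 2 * δ := by rw [abs_le]; constructor <;> linarith
    linarith
  have e : ι ≃ Z := Fintype.equivOfCardEq (by simp [hZ])
  exact isSDCPair_of_real_roots hXA hXB (r ∘ e) (hrinj.comp e.injective) (fun i => hr0 _) t₀ hX0

end RealRoots

/-! ### Density of generic pencils -/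

section Generic

variable {ι : Type*} [Fintype ι] [DecidableEq ι]

theorem Polynomial.Monic.separable_iff_resultant_ne_zero {f : Polynomial ℂ} (hf : f.Monic)
    {N : ℕ} (hN : f.natDegree = N) :
    f.Separable ↔ Polynomial.resultant f f.derivative N (N - 1) ≠ 0 := by
  have h := Polynomial.isUnit_resultant_iff_isCoprime (g := f.derivative) hf
  rw [Polynomial.natDegree_derivative, hN, isUnit_iff_ne_zero] at h
  exact h.symm

/-- A Hermitian pencil is *generic* here if `B` is invertible and `det (A + t • B)` has
`Fintype.card ι` distinct complex roots. -/
def IsGenericPencil (S : Matrix ι ι ℂ × Matrix ι ι ℂ) : Prop :=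
  S.1.IsHermitian ∧ S.2.IsHermitian ∧ S.2.det ≠ 0 ∧
    ∃ l : ι → ℂ, Function.Injective l ∧ ∀ i, (S.1 + l i • S.2).det = 0

theorem exists_roots_of_separable_charpoly {A B : Matrix ι ι ℂ} (hB : B.det ≠ 0)
    (hsep : (B.adjugate * A).charpoly.Separable) :
    ∃ l : ι → ℂ, Function.Injective l ∧ ∀ i, (A + l i • B).det = 0 := by
  set f := (B.adjugate * A).charpoly with hf
  have hcard : f.roots.toFinset.card = Fintype.card ι := by
    rw [Multiset.toFinset_card_of_nodup (Polynomial.nodup_roots hsep),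
      IsAlgClosed.card_roots_eq_natDegree, hf, Matrix.charpoly_natDegree_eq_dim]
  have e : ι ≃ f.roots.toFinset := Fintype.equivOfCardEq (by simp [hcard])
  refine ⟨fun i => -((e i : ℂ) / B.det), ?_, fun i => ?_⟩
  · intro i j hij
    have h : (e i : ℂ) = e j := by
      have := neg_injective hij
      field_simp at this
      exact this
    exact e.injective (Subtype.ext h)
  · have hr : f.eval (e i : ℂ) = 0 := by
      have := (e i).2
      rw [Multiset.mem_toFinset, Polynomial.mem_roots (Matrix.charpoly_monic _).ne_zero] at this
      exact this
    replace hr : (Matrix.scalar ι (e i : ℂ) - B.adjugate * A).det = 0 := by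
      rw [← Matrix.eval_charpoly]
      exact hr
    have h2 : B * (Matrix.scalar ι (e i : ℂ) - B.adjugate * A) =
        (-B.det) • (A + (-((e i : ℂ) / B.det)) • B) := by
      rw [Matrix.mul_sub, ← Matrix.mul_assoc, Matrix.mul_adjugate, smul_add, smul_smul]
      have : -B.det * -((e i : ℂ) / B.det) = e i := by field_simp
      rw [this, Matrix.scalar_apply, ← Matrix.smul_one_eq_diagonal]
      simp only [Matrix.mul_smul, Matrix.mul_one, Matrix.smul_mul, Matrix.one_mul, neg_smul]
      abel
    have h3 := congrArg Matrix.det h2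
    rw [Matrix.det_mul, hr, mul_zero, Matrix.det_smul] at h3
    exact (mul_eq_zero.mp h3.symm).resolve_left (pow_ne_zero _ (neg_ne_zero.mpr hB))

/-- On the segment from a given Hermitian pair to `(D, 1)`, with `D` real diagonal with distinct
entries, genericity is the nonvanishing of a polynomial in the parameter which is nonzero at the
end point; so all but finitely many points of the segment are generic. -/
theorem exists_isGenericPencil_mem_nhds {A B : Matrix ι ι ℂ} (hA : A.IsHermitian)
    (hB : B.IsHermitian) {U : Set (Matrix ι ι ℂ × Matrix ι ι ℂ)} (hU : U ∈ 𝓝 (A, B)) :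
    ∃ S ∈ U, IsGenericPencil S := by
  set d : ι → ℂ := fun i => ((Fintype.equivFin ι i : ℕ) : ℂ) with hd
  have hdinj : Function.Injective d := by
    intro i j hij
    have : (Fintype.equivFin ι i : ℕ) = Fintype.equivFin ι j := Nat.cast_injective hij
    exact (Fintype.equivFin ι).injective (Fin.ext this)
  set D : Matrix ι ι ℂ := Matrix.diagonal d with hD
  have hDH : D.IsHermitian := by
    rw [hD, Matrix.IsHermitian, Matrix.diagonal_conjTranspose]
    congr 1
    ext i
    simp [hd]
  set SA : ℂ → Matrix ι ι ℂ := fun s => A + s • (D - A) with hSA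
  set SB : ℂ → Matrix ι ι ℂ := fun s => B + s • (1 - B) with hSB
  set PA : Matrix ι ι (Polynomial ℂ) :=
    A.map Polynomial.C + (Polynomial.X : Polynomial ℂ) • (D - A).map Polynomial.C with hPA
  set PB : Matrix ι ι (Polynomial ℂ) :=
    B.map Polynomial.C + (Polynomial.X : Polynomial ℂ) • (1 - B).map Polynomial.C with hPB
  have hPAe : ∀ s, (Polynomial.evalRingHom s).mapMatrix PA = SA s := by
    intro s; ext i j; simp [hPA, hSA]
  have hPBe : ∀ s, (Polynomial.evalRingHom s).mapMatrix PB = SB s := by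
    intro s; ext i j; simp [hPB, hSB]
  set N := Fintype.card ι
  set χ := (PB.adjugate * PA).charpoly with hχ
  have hχe : ∀ s, χ.map (Polynomial.evalRingHom s) = ((SB s).adjugate * SA s).charpoly := by
    intro s
    rw [hχ, ← Matrix.charpoly_map]
    congr 1
    rw [← RingHom.mapMatrix_apply, map_mul, RingHom.map_adjugate, hPAe, hPBe]
  set p : Polynomial ℂ := Polynomial.resultant χ χ.derivative N (N - 1) * PB.det with hp
  have hpe : ∀ s, p.eval s ≠ 0 ↔
      ((SB s).adjugate * SA s).charpoly.Separable ∧ (SB s).det ≠ 0 := by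
    intro s
    rw [Polynomial.Monic.separable_iff_resultant_ne_zero (Matrix.charpoly_monic _)
      (Matrix.charpoly_natDegree_eq_dim _), ← hχe, Polynomial.derivative_map,
      Polynomial.resultant_map_map, ← hPBe, ← RingHom.map_det, ← mul_ne_zero_iff, ← map_mul]
    rfl
  have hp1 : p.eval 1 ≠ 0 := by
    rw [hpe]
    have h1 : SA 1 = D := by simp [hSA]
    have h2 : SB 1 = 1 := by simp [hSB]
    rw [h1, h2]
    refine ⟨?_, by simp⟩
    rw [Matrix.adjugate_one, one_mul, hD, Matrix.charpoly_diagonal]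
    exact Polynomial.separable_prod_X_sub_C_iff.mpr hdinj
  have hp0 : p ≠ 0 := by
    rintro h
    simp [h] at hp1
  have hfin : {s : ℝ | p.eval (s : ℂ) = 0}.Finite := by
    have : {s : ℂ | p.eval s = 0}.Finite := by
      refine (p.roots.toFinset.finite_toSet).subset fun s hs => ?_
      simpa [hp0] using hs
    exact this.preimage (Complex.ofReal_injective.injOn)
  have hcont : ContinuousAt (fun s : ℝ => (SA s, SB s)) 0 := by
    refine Continuous.continuousAt ?_
    simp only [hSA, hSB]
    fun_prop
  have hmem : ∀ᶠ s : ℝ in 𝓝[≠] 0, (SA s, SB s) ∈ U := by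
    refine Filter.Eventually.filter_mono nhdsWithin_le_nhds (hcont.eventually ?_)
    simpa [hSA, hSB] using hU
  have hne : ∀ᶠ s : ℝ in 𝓝[≠] 0, p.eval (s : ℂ) ≠ 0 := by
    have h1 : ({s : ℝ | p.eval (s : ℂ) = 0} \ {0})ᶜ ∈ 𝓝 (0 : ℝ) :=
      (hfin.sdiff).isClosed.isOpen_compl.mem_nhds (by simp)
    filter_upwards [nhdsWithin_le_nhds h1, self_mem_nhdsWithin] with s hs hs0 h
    exact hs ⟨h, hs0⟩
  obtain ⟨s, hsU, hs⟩ := (hmem.and hne).exists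
  obtain ⟨h1, h2⟩ := (hpe s).mp hs
  exact ⟨_, hsU, hA.add_real_smul (hDH.sub hA) s,
    hB.add_real_smul (Matrix.isHermitian_one.sub hB) s, h2, exists_roots_of_separable_charpoly h2 h1⟩

end Generic

/-! ### Real-rooted polynomials with prescribed signs -/

section PrescribedSigns

/-- A real-rooted polynomial with simple roots can be given any signs at the points of `S`, up to
one global sign, once its degree is at least the number of points: a root placed between two
neighbouring points, or to the right of all of them, adjusts one sign at a time. -/
theorem exists_roots_with_signs (s : ℝ → ℝ) (F S : Finset ℝ) (hs : ∀ x ∈ S, s x ≠ 0) (N : ℕ)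
    (hN : S.card ≤ N) :
    ∃ Z : Finset ℝ, Z.card = N ∧ Disjoint Z F ∧
      ∃ c : ℝ, c ≠ 0 ∧ ∀ x ∈ S, 0 < c * s x * ∏ z ∈ Z, (x - z) := by
  induction N, hN using Nat.le_induction with
  | base =>
    induction S using Finset.induction_on_max generalizing F with
    | empty => exact ⟨∅, by simp, by simp, 1, by simp, by simp⟩
    | insert a S hmax ih =>
      obtain ⟨Z, hZ, hZF, c, hc, hpos⟩ :=
        ih (insert a F) fun x hx => hs x (Finset.mem_insert_of_mem hx)
      have haS : a ∉ S := fun h => lt_irrefl _ (hmax a h)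
      have haZ : a ∉ Z := fun h =>
        Finset.disjoint_left.mp hZF h (Finset.mem_insert_self _ _)
      have hprod : ∏ z ∈ Z, (a - z) ≠ 0 := by
        rw [Finset.prod_ne_zero_iff]
        intro z hz h
        exact haZ (by rwa [sub_eq_zero.mp h])
      have hne : c * s a * ∏ z ∈ Z, (a - z) ≠ 0 :=
        mul_ne_zero (mul_ne_zero hc (hs a (Finset.mem_insert_self _ _))) hprod
      -- The new root lies to the left or to the right of `a`, according to the sign needed there.
      obtain ⟨z, hzS, hzF, hzZ, hza⟩ : ∃ z : ℝ, (∀ x ∈ S, x < z) ∧ z ∉ F ∧ z ∉ Z ∧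
          0 < -(c * s a * ∏ z ∈ Z, (a - z)) * (a - z) := by
        rcases hne.lt_or_gt with hlt | hgt
        · have hev : ∀ᶠ z in 𝓝[<] a, ∀ x ∈ S ∪ F ∪ Z, x < a → x < z := by
            rw [eventually_all_finset]
            intro x _
            by_cases hx : x < a
            · filter_upwards [nhdsWithin_le_nhds (Ioi_mem_nhds hx)] with z hz _ using hz
            · simp [hx]
          obtain ⟨z, hz, hza⟩ := (hev.and self_mem_nhdsWithin).exists
          have hza : z < a := hza
          refine ⟨z, fun x hx => hz x (by simp [hx]) (hmax x hx), fun h => ?_, fun h => ?_, ?_⟩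
          · exact lt_irrefl _ (hz z (by simp [h]) hza)
          · exact lt_irrefl _ (hz z (by simp [h]) hza)
          · exact mul_pos (neg_pos.mpr hlt) (sub_pos.mpr hza)
        · have hev : ∀ᶠ z in atTop, ∀ x ∈ insert a (S ∪ F ∪ Z), x < z := by
            rw [eventually_all_finset]
            exact fun x _ => eventually_gt_atTop x
          obtain ⟨z, hz⟩ := hev.exists
          refine ⟨z, fun x hx => hz x (by simp [hx]), fun h => ?_, fun h => ?_, ?_⟩
          · exact lt_irrefl _ (hz z (by simp [h]))
          · exact lt_irrefl _ (hz z (by simp [h]))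
          · exact mul_pos_of_neg_of_neg (neg_neg_iff_pos.mpr hgt)
              (sub_neg.mpr (hz a (Finset.mem_insert_self _ _)))
      refine ⟨insert z Z, ?_, ?_, -c, neg_ne_zero.mpr hc, ?_⟩
      · rw [Finset.card_insert_of_notMem hzZ, Finset.card_insert_of_notMem haS, hZ]
      · rw [Finset.disjoint_insert_left]
        exact ⟨hzF, hZF.mono_right (Finset.subset_insert _ _)⟩
      · intro x hx
        rw [Finset.prod_insert hzZ]
        rcases Finset.mem_insert.mp hx with rfl | hx
        · calc _ < _ := hza
            _ = _ := by ring
        · calc 0 < (c * s x * ∏ z ∈ Z, (x - z)) * (z - x) :=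
                mul_pos (hpos x hx) (sub_pos.mpr (hzS x hx))
            _ = _ := by ring
  | succ N hN ih =>
    obtain ⟨Z, hZ, hZF, c, hc, hpos⟩ := ih
    have hev : ∀ᶠ z in atTop, ∀ x ∈ S ∪ F ∪ Z, x < z := by
      rw [eventually_all_finset]
      exact fun x _ => eventually_gt_atTop x
    obtain ⟨z, hz⟩ := hev.exists
    have hzZ : z ∉ Z := fun h => lt_irrefl _ (hz z (by simp [h]))
    refine ⟨insert z Z, by rw [Finset.card_insert_of_notMem hzZ, hZ], ?_, -c,
      neg_ne_zero.mpr hc, fun x hx => ?_⟩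
    · rw [Finset.disjoint_insert_left]
      exact ⟨fun h => lt_irrefl _ (hz z (by simp [h])), hZF⟩
    · rw [Finset.prod_insert hzZ]
      calc 0 < (c * s x * ∏ z ∈ Z, (x - z)) * (z - x) :=
            mul_pos (hpos x hx) (sub_pos.mpr (hz x (by simp [hx])))
        _ = _ := by ring

end PrescribedSigns

/-! ### Schur complements of a generic pencil -/

section Realization

/-- Conjugate-symmetric data can be factored along the conjugation of the indices, provided they
are positive at its fixed points. -/
theorem exists_star_mul_eq {μ : Type*} {l : μ → ℂ} (hl : Function.Injective l) {σ : μ → μ}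
    (hσ : ∀ i, l (σ i) = star (l i)) {r : μ → ℂ} (hr : ∀ i, r (σ i) = star (r i))
    (hpos : ∀ i, σ i = i → 0 < (r i).re) : ∃ c : μ → ℂ, ∀ i, star (c (σ i)) * c i = r i := by
  refine ⟨fun i => if (l i).im = 0 then (Real.sqrt (r i).re : ℂ) else if 0 < (l i).im then r i
    else 1, fun i => ?_⟩
  have him : (l (σ i)).im = -(l i).im := by rw [hσ]; simp
  rcases lt_trichotomy (l i).im 0 with h | h | h
  · have h1 : (l (σ i)).im ≠ 0 := by rw [him]; linarith
    have h2 : 0 < (l (σ i)).im := by rw [him]; linarith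
    simp [h.ne, h.not_gt, h1, h2, hr]
  · have hfix : σ i = i := hl (by rw [hσ]; exact Complex.conj_eq_iff_im.mpr h)
    have hri : (r i).im = 0 := by
      have := hr i
      rw [hfix] at this
      exact Complex.conj_eq_iff_im.mp this.symm
    simp only [hfix, h, if_true]
    rw [Complex.star_def, Complex.conj_ofReal, ← Complex.ofReal_mul,
      Real.mul_self_sqrt (hpos i hfix).le]
    exact Complex.ext (by simp) (by simp [hri])
  · have h1 : (l (σ i)).im ≠ 0 := by rw [him]; linarith
    have h2 : ¬ 0 < (l (σ i)).im := by rw [him]; linarith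
    simp [h.ne', h, h1, h2]

variable {μ : Type*} [Fintype μ] [DecidableEq μ]

/-- The roots of a generic Hermitian pencil are permuted by complex conjugation, and its kernel
vectors pair nontrivially under `B` exactly when they belong to conjugate roots. -/
theorem exists_dual_kernel_vectors {A B : Matrix μ μ ℂ} (hA : A.IsHermitian) (hB : B.IsHermitian)
    (hBdet : B.det ≠ 0) {l : μ → ℂ} (hl : Function.Injective l)
    (hdet : ∀ i, (A + l i • B).det = 0) :
    ∃ (x : μ → μ → ℂ) (σ : μ → μ), (∀ i, A *ᵥ x i = -(l i • B *ᵥ x i)) ∧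
      (∀ i, l (σ i) = star (l i)) ∧ ∀ i j, star (x i) ⬝ᵥ B *ᵥ x j ≠ 0 ↔ i = σ j := by
  choose x hx0 hx using fun i => Matrix.exists_mulVec_eq_zero_iff.mpr (hdet i)
  have hx' : ∀ i, A *ᵥ x i = -(l i • B *ᵥ x i) := by
    intro i
    have := hx i
    rw [Matrix.add_mulVec, Matrix.smul_mulVec] at this
    exact eq_neg_of_add_eq_zero_left this
  have hBu : IsUnit B.det := isUnit_iff_ne_zero.mpr hBdet
  have hli : LinearIndependent ℂ x := by
    refine Module.End.eigenvectors_linearIndependent' (Matrix.toLin' (B⁻¹ * A))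
      (fun i => -l i) (neg_injective.comp hl) x ?_
    intro i
    rw [Module.End.hasEigenvector_iff, Module.End.mem_eigenspace_iff]
    refine ⟨?_, hx0 i⟩
    rw [Matrix.toLin'_apply, ← Matrix.mulVec_mulVec, hx' i, Matrix.mulVec_neg, Matrix.mulVec_smul,
      Matrix.mulVec_mulVec, Matrix.nonsing_inv_mul _ hBu, Matrix.one_mulVec, neg_smul]
  have hX : IsUnit (Matrix.of x) := by
    rw [← Matrix.linearIndependent_rows_iff_isUnit]
    exact hli
  have hconj : ∀ i j, star (x i) ⬝ᵥ B *ᵥ x j ≠ 0 → l j = star (l i) := by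
    intro i j hij
    have h1 : star (x i) ⬝ᵥ A *ᵥ x j = -(l j * star (x i) ⬝ᵥ B *ᵥ x j) := by
      rw [hx' j, dotProduct_neg, dotProduct_smul, smul_eq_mul]
    have h2 : star (x i) ⬝ᵥ A *ᵥ x j = -(star (l i) * star (x i) ⬝ᵥ B *ᵥ x j) := by
      rw [← hA.star_mulVec_dotProduct, hx' i, star_neg, star_smul, neg_dotProduct, smul_dotProduct,
        hB.star_mulVec_dotProduct, smul_eq_mul]
    have h3 : (l j - star (l i)) * star (x i) ⬝ᵥ B *ᵥ x j = 0 := by linear_combination h1 - h2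
    exact sub_eq_zero.mp ((mul_eq_zero.mp h3).resolve_right hij)
  have hex : ∀ j, ∃ i, star (x i) ⬝ᵥ B *ᵥ x j ≠ 0 := by
    intro j
    by_contra! h
    have h1 : Matrix.of (star x) *ᵥ (B *ᵥ x j) = 0 := by
      ext i
      exact h i
    have h2 : IsUnit (Matrix.of (star x)) := by
      have : Matrix.of (star x) = (Matrix.of x).map star := rfl
      rw [this]
      exact hX.map (starRingEnd ℂ).mapMatrix
    have h3 : B *ᵥ x j = 0 := by
      refine Matrix.mulVec_injective_iff_isUnit.mpr h2 ?_
      simpa using h1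
    exact hx0 j (Matrix.mulVec_injective_iff_isUnit.mpr ((Matrix.isUnit_iff_isUnit_det _).mpr hBu)
      (by simpa using h3))
  choose σ hσ using hex
  refine ⟨x, σ, hx', fun i => ?_, fun i j => ⟨fun h => hl ?_, ?_⟩⟩
  · rw [hconj _ _ (hσ i), star_star]
  · have h1 := hconj _ _ h
    rw [hconj _ _ (hσ j)] at h1
    exact (star_injective h1).symm
  · rintro rfl
    exact hσ j

/-- Every rational function `f / χ` with denominator the product of `X - l i` splits as polynomial
part plus simple poles. -/
theorem eval_eq_nodal_mul {l : μ → ℂ} (hl : Function.Injective l) (f : Polynomial ℂ) {t : ℂ}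
    (ht : ∀ i, t ≠ l i) :
    f.eval t = (Lagrange.nodal Finset.univ l).eval t *
      ((f /ₘ Lagrange.nodal Finset.univ l).eval t +
        ∑ i, f.eval (l i) * Lagrange.nodalWeight Finset.univ l i * (t - l i)⁻¹) := by
  set χ := Lagrange.nodal Finset.univ l
  have hχ : χ.Monic := Lagrange.nodal_monic
  have hdiv := Polynomial.modByMonic_add_div f χ
  have hr : f %ₘ χ = Lagrange.interpolate Finset.univ l fun i => f.eval (l i) := by
    refine Lagrange.eq_interpolate_of_eval_eq _ hl.injOn ?_ ?_
    · have := Polynomial.degree_modByMonic_lt f hχ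
      rwa [Lagrange.degree_nodal] at this
    · intro i hi
      have h0 : χ.eval (l i) = 0 := Lagrange.eval_nodal_at_node hi
      conv_rhs => rw [← hdiv]
      rw [Polynomial.eval_add, Polynomial.eval_mul, h0, zero_mul, add_zero]
  conv_lhs => rw [← hdiv, hr]
  rw [Polynomial.eval_add, Polynomial.eval_mul,
    Lagrange.eval_interpolate_not_at_node _ fun i _ => ht i, mul_add, add_comm]
  congr 2
  refine Finset.sum_congr rfl fun i _ => ?_
  ring

/-- Against a generic pencil `A + t • B`, one can choose a vector `b` and a real polynomial `q` of
degree at most `N - card μ` such that `q t - bᴴ (A + t • B)⁻¹ b` has `N` distinct real zeros. In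
the statement, `y` is `(A + t • B)⁻¹ b`. -/
theorem exists_real_rooted_schur_complement {A B : Matrix μ μ ℂ} (hAB : IsGenericPencil (A, B))
    {N : ℕ} (hN : Fintype.card μ ≤ N) :
    ∃ (Z : Finset ℝ) (b : μ → ℂ) (q : Polynomial ℂ), Z.card = N ∧ 0 ∉ Z ∧
      q.natDegree ≤ N - Fintype.card μ ∧ (∀ k, star (q.coeff k) = q.coeff k) ∧
      (∀ z ∈ Z, (A + (z : ℂ) • B).det ≠ 0) ∧
      ∀ t : ℝ, (A + (t : ℂ) • B).det ≠ 0 →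
        ∃ y, (A + (t : ℂ) • B) *ᵥ y = b ∧ (q.eval (t : ℂ) = star b ⬝ᵥ y ↔ t ∈ Z) := by
  obtain ⟨hA, hB, hBdet, l, hl, hdet⟩ := hAB
  obtain ⟨x, σ, hx, hσ, hG⟩ := exists_dual_kernel_vectors hA hB hBdet hl hdet
  dsimp only at hA hB hBdet hdet hx hG
  have hσσ : ∀ i, σ (σ i) = i := fun i => hl (by rw [hσ, hσ, star_star])
  set χ := Lagrange.nodal Finset.univ l with hχdef
  have hχ : χ.Monic := Lagrange.nodal_monic
  have hχconj : χ.map (starRingEnd ℂ) = χ := by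
    rw [hχdef, Lagrange.nodal, Polynomial.map_prod]
    refine Finset.prod_nbij σ (by simp) ?_ ?_ ?_
    · exact (Function.LeftInverse.injective hσσ).injOn
    · intro i _
      exact ⟨σ i, by simp, hσσ i⟩
    · intro i _
      rw [hσ]
      simp
  have hwt : ∀ i, Lagrange.nodalWeight Finset.univ l i = (χ.derivative.eval (l i))⁻¹ :=
    fun i => Lagrange.nodalWeight_eq_eval_derivative_nodal (Finset.mem_univ i)
  have hwt0 : ∀ i, Lagrange.nodalWeight Finset.univ l i ≠ 0 :=
    fun i => Lagrange.nodalWeight_ne_zero hl.injOn (Finset.mem_univ i)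
  have heval : ∀ (f : Polynomial ℂ), f.map (starRingEnd ℂ) = f → ∀ z : ℂ,
      f.eval (star z) = star (f.eval z) := by
    intro f hf z
    conv_lhs => rw [← hf]
    rw [Polynomial.eval_map, Complex.star_def, Polynomial.eval₂_hom]
  have hwtσ : ∀ i, Lagrange.nodalWeight Finset.univ l (σ i) =
      star (Lagrange.nodalWeight Finset.univ l i) := by
    intro i
    rw [hwt, hwt, hσ, heval _ (by rw [← Polynomial.derivative_map, hχconj]), star_inv₀]
  set G : μ → ℂ := fun j => star (x (σ j)) ⬝ᵥ B *ᵥ x j with hGdef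
  have hG0 : ∀ j, G j ≠ 0 := fun j => (hG _ _).mpr rfl
  have hGσ : ∀ j, G (σ j) = star (G j) := by
    intro j
    simp only [hGdef, hσσ]
    rw [← hB.star_mulVec_dotProduct, ← Matrix.star_dotProduct_star, star_star, dotProduct_comm]
  -- `u j` is the weight multiplying the value of the polynomial at `l j` in `star (c (σ j)) * c j`.
  set u : μ → ℂ := fun j => -(Lagrange.nodalWeight Finset.univ l j / G j) with hu
  have huσ : ∀ j, u (σ j) = star (u j) := by
    intro j
    simp only [hu, hwtσ, hGσ]
    rw [star_neg, star_div₀]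
  have hu0 : ∀ j, u j ≠ 0 := fun j => neg_ne_zero.mpr (div_ne_zero (hwt0 j) (hG0 j))
  have hureal : ∀ j, σ j = j → u j = (u j).re := by
    intro j hj
    have := huσ j
    rw [hj] at this
    exact (Complex.conj_eq_iff_re.mp this.symm).symm
  have hlreal : ∀ j, σ j = j → l j = (l j).re := by
    intro j hj
    have := hσ j
    rw [hj] at this
    exact (Complex.conj_eq_iff_re.mp this.symm).symm
  set S : Finset ℝ := (Finset.univ.filter fun j => σ j = j).image fun j => (l j).re with hS
  obtain ⟨s, hs⟩ : ∃ s : ℝ → ℝ, ∀ j, σ j = j → s (l j).re = (u j).re := by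
    refine ⟨fun y => (Function.extend l u 0 (y : ℂ)).re, fun j hj => ?_⟩
    dsimp only
    rw [← hlreal j hj, hl.extend_apply]
  obtain ⟨Z, hZ, hZF, c₀, hc₀, hpos⟩ := exists_roots_with_signs s (insert 0 S) S (by
      intro y hy
      simp only [hS, Finset.mem_image, Finset.mem_filter, Finset.mem_univ, true_and] at hy
      obtain ⟨j, hj, rfl⟩ := hy
      rw [hs j hj]
      intro h
      apply hu0 j
      rw [hureal j hj, h]
      simp) N (Finset.card_image_le.trans ((Finset.card_filter_le _ _).trans hN))
  have hZS : ∀ z ∈ Z, z ∉ insert 0 S := fun z hz => Finset.disjoint_left.mp hZF hz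
  set f : Polynomial ℂ := Polynomial.C (c₀ : ℂ) * ∏ z ∈ Z, (Polynomial.X - Polynomial.C (z : ℂ))
    with hf
  have hfe : ∀ t : ℂ, f.eval t = c₀ * ∏ z ∈ Z, (t - z) := by
    intro t
    simp [hf, Polynomial.eval_prod]
  have hfconj : f.map (starRingEnd ℂ) = f := by
    simp [hf, Polynomial.map_prod]
  have hfdeg : f.natDegree = N := by
    rw [hf, Polynomial.natDegree_C_mul (by exact_mod_cast hc₀),
      Polynomial.natDegree_prod_of_monic _ _ fun z _ => Polynomial.monic_X_sub_C _]
    simp [hZ]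
  set r : μ → ℂ := fun j => f.eval (l j) * u j with hr
  obtain ⟨c, hc⟩ := exists_star_mul_eq hl hσ (r := r)
    (by
      intro i
      simp only [hr, hσ, heval f hfconj, huσ]
      rw [star_mul'])
    (by
      intro i hi
      have h1 : (l i).re ∈ S := by
        simp only [hS, Finset.mem_image, Finset.mem_filter, Finset.mem_univ, true_and]
        exact ⟨i, hi, rfl⟩
      have h2 := hpos _ h1
      rw [hs i hi] at h2
      have h3 : r i = ((c₀ * (u i).re * ∏ z ∈ Z, ((l i).re - z) : ℝ) : ℂ) := by
        simp only [hr, hfe]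
        rw [hureal i hi, hlreal i hi]
        push_cast
        simp only [Complex.ofReal_re]
        ring
      rw [h3, Complex.ofReal_re]
      exact h2)
  have hpencil : ∀ (t : ℂ) j, (A + t • B) *ᵥ x j = (t - l j) • B *ᵥ x j := by
    intro t j
    rw [Matrix.add_mulVec, Matrix.smul_mulVec, hx, sub_smul]
    abel
  have hnode : ∀ t : ℂ, (A + t • B).det ≠ 0 → ∀ j, t ≠ l j := by
    rintro t ht j rfl
    exact ht (hdet j)
  set b : μ → ℂ := B *ᵥ ∑ j, c j • x j with hb
  -- Evaluating the Hermitian form of the inverse pencil at `b` in the basis of kernel vectors.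
  have hform : ∀ t : ℂ, star b ⬝ᵥ (∑ j, (c j * (t - l j)⁻¹) • x j) =
      ∑ j, r j * G j * (t - l j)⁻¹ := by
    intro t
    rw [dotProduct_sum]
    refine Finset.sum_congr rfl fun j _ => ?_
    rw [dotProduct_smul, hb, hB.star_mulVec_dotProduct, star_sum, sum_dotProduct,
      Finset.sum_eq_single (σ j)]
    · rw [star_smul, smul_dotProduct, ← hc j]
      simp only [smul_eq_mul, hGdef]
      ring
    · intro i _ hi
      rw [star_smul, smul_dotProduct, not_ne_iff.mp ((hG i j).not.mpr hi), smul_zero]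
    · simp
  have hqdeg : (f /ₘ χ).natDegree ≤ N - Fintype.card μ := by
    rw [Polynomial.natDegree_divByMonic f hχ, hfdeg, Lagrange.natDegree_nodal, Finset.card_univ]
  refine ⟨Z, b, f /ₘ χ, hZ, fun h => hZS 0 h (Finset.mem_insert_self _ _), hqdeg, ?_, ?_, ?_⟩
  · intro k
    have := congrArg (fun p => Polynomial.coeff p k)
      (Polynomial.map_divByMonic (starRingEnd ℂ) hχ (p := f))
    simp only [hfconj, hχconj, Polynomial.coeff_map] at this
    exact this
  · intro z hz h
    rw [det_pencil_eq_mul_prod A B rfl hl hdet, mul_eq_zero, or_iff_right hBdet,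
      Finset.prod_eq_zero_iff] at h
    obtain ⟨j, -, hj⟩ := h
    have hzj : (z : ℂ) = l j := sub_eq_zero.mp hj
    have hfix : σ j = j := hl (by rw [hσ, ← hzj, Complex.star_def, Complex.conj_ofReal])
    refine hZS z hz (Finset.mem_insert_of_mem ?_)
    simp only [hS, Finset.mem_image, Finset.mem_filter, Finset.mem_univ, true_and]
    exact ⟨j, hfix, by rw [← hzj, Complex.ofReal_re]⟩
  · intro t ht
    have htl := hnode t ht
    refine ⟨∑ j, (c j * ((t : ℂ) - l j)⁻¹) • x j, ?_, ?_⟩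
    · rw [hb, Matrix.mulVec_sum, Matrix.mulVec_sum]
      refine Finset.sum_congr rfl fun j _ => ?_
      rw [Matrix.mulVec_smul, Matrix.mulVec_smul, hpencil, smul_smul, mul_assoc,
        inv_mul_cancel₀ (sub_ne_zero.mpr (htl j)), mul_one]
    · rw [hform]
      have h1 := eval_eq_nodal_mul hl f htl
      have h2 : ∑ j, r j * G j * ((t : ℂ) - l j)⁻¹ =
          -∑ i, f.eval (l i) * Lagrange.nodalWeight Finset.univ l i * ((t : ℂ) - l i)⁻¹ := by
        rw [← Finset.sum_neg_distrib]
        refine Finset.sum_congr rfl fun j _ => ?_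
        simp only [hr, hu]
        have := hG0 j
        field_simp
      have h3 : χ.eval (t : ℂ) ≠ 0 := Lagrange.eval_nodal_not_at_node fun i _ => htl i
      have h4 : f.eval (t : ℂ) = 0 ↔ t ∈ Z := by
        rw [hfe, mul_eq_zero, Finset.prod_eq_zero_iff]
        constructor
        · rintro (h | ⟨z, hz, h⟩)
          · exact absurd (by exact_mod_cast h) hc₀
          · have : t = z := by exact_mod_cast sub_eq_zero.mp h
            rwa [this]
        · intro h
          exact Or.inr ⟨t, h, sub_self _⟩
      rw [h2, ← h4, h1, mul_eq_zero, or_iff_right h3, eq_neg_iff_add_eq_zero]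

end Realization

/-! ### Hermitian block matrices -/

section BlockPencil

variable {α β γ : Type*}

/-- The Hermitian block matrix with rows `E, M, a`, then `Mᴴ, N, K`, then `aᴴ, Kᴴ, R`. -/
def hermBlock (E : Matrix α α ℂ) (M : Matrix α β ℂ) (a : Matrix α γ ℂ) (N : Matrix β β ℂ)
    (K : Matrix β γ ℂ) (R : Matrix γ γ ℂ) : Matrix (α ⊕ (β ⊕ γ)) (α ⊕ (β ⊕ γ)) ℂ :=
  Matrix.fromBlocks E (Matrix.fromCols M a) (Matrix.fromRows Mᴴ aᴴ) (Matrix.fromBlocks N K Kᴴ R)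

theorem hermBlock_isHermitian {E : Matrix α α ℂ} {N : Matrix β β ℂ} {R : Matrix γ γ ℂ}
    (hE : E.IsHermitian) (hN : N.IsHermitian) (hR : R.IsHermitian) (M : Matrix α β ℂ)
    (a : Matrix α γ ℂ) (K : Matrix β γ ℂ) : (hermBlock E M a N K R).IsHermitian := by
  refine hE.fromBlocks ?_ (hN.fromBlocks rfl hR)
  ext (i | i) j <;> rfl

theorem continuous_hermBlock {X : Type*} [TopologicalSpace X] {E : X → Matrix α α ℂ}
    {M : X → Matrix α β ℂ} {a : X → Matrix α γ ℂ} {N : X → Matrix β β ℂ} {K : X → Matrix β γ ℂ}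
    {R : X → Matrix γ γ ℂ} (hE : Continuous E) (hM : Continuous M) (ha : Continuous a)
    (hN : Continuous N) (hK : Continuous K) (hR : Continuous R) :
    Continuous fun x => hermBlock (E x) (M x) (a x) (N x) (K x) (R x) := by
  refine continuous_matrix fun i j => ?_
  rcases i with i | i | i <;> rcases j with j | j | j
  · exact hE.matrix_elem i j
  · exact hM.matrix_elem i j
  · exact ha.matrix_elem i j
  · exact (hM.matrix_elem j i).star
  · exact hN.matrix_elem i j
  · exact hK.matrix_elem i j
  · exact (ha.matrix_elem j i).star
  · exact (hK.matrix_elem j i).star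
  · exact hR.matrix_elem i j

/-- The lower left blocks of a Hermitian block matrix are determined by the upper right ones. -/
theorem Matrix.IsHermitian.eq_hermBlock {X : Matrix (α ⊕ (β ⊕ γ)) (α ⊕ (β ⊕ γ)) ℂ}
    (hX : X.IsHermitian) {E : Matrix α α ℂ} {M : Matrix α β ℂ} {a : Matrix α γ ℂ}
    (hE : ∀ i j, X (Sum.inl i) (Sum.inl j) = E i j)
    (hM : ∀ i j, X (Sum.inl i) (Sum.inr (Sum.inl j)) = M i j)
    (ha : ∀ i j, X (Sum.inl i) (Sum.inr (Sum.inr j)) = a i j) :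
    X = hermBlock E M a (X.submatrix (Sum.inr ∘ Sum.inl) (Sum.inr ∘ Sum.inl))
      (X.submatrix (Sum.inr ∘ Sum.inl) (Sum.inr ∘ Sum.inr))
      (X.submatrix (Sum.inr ∘ Sum.inr) (Sum.inr ∘ Sum.inr)) := by
  ext (i | i | i) (j | j | j)
  · exact hE i j
  · exact hM i j
  · exact ha i j
  · exact (hX.apply _ _).symm.trans (congrArg star (hM j i))
  · rfl
  · rfl
  · exact (hX.apply _ _).symm.trans (congrArg star (ha j i))
  · exact (hX.apply _ _).symm
  · rfl

theorem hermBlock_add_real_smul (E₀ E₁ : Matrix α α ℂ) (M₀ M₁ : Matrix α β ℂ)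
    (a₀ a₁ : Matrix α γ ℂ) (N₀ N₁ : Matrix β β ℂ) (K₀ K₁ : Matrix β γ ℂ) (R₀ R₁ : Matrix γ γ ℂ)
    (t : ℝ) :
    hermBlock E₀ M₀ a₀ N₀ K₀ R₀ + (t : ℂ) • hermBlock E₁ M₁ a₁ N₁ K₁ R₁ =
      hermBlock (E₀ + (t : ℂ) • E₁) (M₀ + (t : ℂ) • M₁) (a₀ + (t : ℂ) • a₁)
        (N₀ + (t : ℂ) • N₁) (K₀ + (t : ℂ) • K₁) (R₀ + (t : ℂ) • R₁) := by
  ext (i | i | i) (j | j | j) <;> simp [hermBlock]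

theorem hermBlock_mulVec [Fintype α] [Fintype β] [Fintype γ] (E : Matrix α α ℂ)
    (M : Matrix α β ℂ) (a : Matrix α γ ℂ) (R : Matrix γ γ ℂ) (x : α → ℂ) (y : β → ℂ)
    (w : γ → ℂ) :
    hermBlock E M a 0 0 R *ᵥ Sum.elim x (Sum.elim y w) =
      Sum.elim (E *ᵥ x + M *ᵥ y + a *ᵥ w) (Sum.elim (Mᴴ *ᵥ x) (aᴴ *ᵥ x + R *ᵥ w)) := by
  rw [hermBlock, Matrix.fromBlocks_mulVec]
  simp only [Sum.elim_comp_inl, Sum.elim_comp_inr, Matrix.fromCols_mulVec, Matrix.fromRows_mulVec,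
    Matrix.fromBlocks_mulVec, Matrix.conjTranspose_zero, Matrix.zero_mulVec, zero_add]
  ext (i | i | i) <;> simp [add_assoc]

/-- A block matrix with three diagonal blocks scaled by `s`, `s⁻¹` and `1`. -/
noncomputable def blockScaling [DecidableEq α] [DecidableEq β] [DecidableEq γ] (s : ℂ) :
    Matrix (α ⊕ (β ⊕ γ)) (α ⊕ (β ⊕ γ)) ℂ :=
  Matrix.diagonal (Sum.elim (fun _ => s) (Sum.elim (fun _ => s⁻¹) fun _ => 1))

theorem blockScaling_congr [Fintype α] [Fintype β] [Fintype γ] [DecidableEq α] [DecidableEq β]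
    [DecidableEq γ] (E : Matrix α α ℂ) (M : Matrix α β ℂ) (a : Matrix α γ ℂ) (N : Matrix β β ℂ)
    (K : Matrix β γ ℂ) (R : Matrix γ γ ℂ) {s : ℝ} (hs : s ≠ 0) :
    (blockScaling (s : ℂ))ᴴ * hermBlock E M a (((s ^ 2 : ℝ) : ℂ) • N) ((s : ℂ) • K) R *
        blockScaling (s : ℂ) =
      hermBlock (((s ^ 2 : ℝ) : ℂ) • E) M ((s : ℂ) • a) N K R := by
  have hs' : (s : ℂ) ≠ 0 := by exact_mod_cast hs
  rw [blockScaling, Matrix.diagonal_conjTranspose]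
  ext i j
  rw [Matrix.mul_diagonal, Matrix.diagonal_mul]
  rcases i with i | i | i <;> rcases j with j | j | j <;> simp [hermBlock] <;> field_simp

end BlockPencil

/-! ### The shift pencil and its Schur complement -/

section SingularBlock

/-- The constant coefficient of the rectangular pencil whose transpose annihilates
`(1, t, …, t ^ e)`. -/
def shiftConst (e : ℕ) : Matrix (Fin (e + 1)) (Fin e) ℂ :=
  Matrix.of fun i j => if i = j.succ then 1 else 0

/-- The coefficient of `t` in the rectangular pencil whose transpose annihilates
`(1, t, …, t ^ e)`. -/
def shiftLin (e : ℕ) : Matrix (Fin (e + 1)) (Fin e) ℂ :=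
  Matrix.of fun i j => if i = j.castSucc then -1 else 0

theorem shift_mulVec {e : ℕ} (t : ℂ) {Φ : ℕ → ℂ} (h0 : Φ 0 = 0) (he : Φ (e + 1) = 0)
    (i : Fin (e + 1)) :
    ((shiftConst e + t • shiftLin e) *ᵥ fun j => Φ (j + 1)) i = Φ i - t * Φ (i + 1) := by
  rw [Matrix.add_mulVec, Matrix.smul_mulVec, Pi.add_apply, Pi.smul_apply, smul_eq_mul]
  have h1 : (shiftConst e *ᵥ fun j => Φ (j + 1)) i = Φ i := by
    simp only [Matrix.mulVec, dotProduct, shiftConst, Matrix.of_apply, ite_mul, one_mul, zero_mul]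
    refine Fin.cases ?_ (fun k => ?_) i
    · simp [h0, (Fin.succ_ne_zero _).symm]
    · simp [Fin.succ_inj]
  have h2 : (shiftLin e *ᵥ fun j => Φ (j + 1)) i = -Φ (i + 1) := by
    simp only [Matrix.mulVec, dotProduct, shiftLin, Matrix.of_apply, ite_mul, neg_mul, one_mul,
      zero_mul]
    refine Fin.lastCases ?_ (fun k => ?_) i
    · rw [Fin.val_last, he, neg_zero]
      exact Finset.sum_eq_zero fun j _ => if_neg (Fin.castSucc_lt_last j).ne'
    · simp [Fin.castSucc_inj]
  rw [h1, h2]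
  ring

theorem shift_conjTranspose_mulVec {e : ℕ} (t : ℝ) (x : Fin (e + 1) → ℂ) (j : Fin e) :
    ((shiftConst e + (t : ℂ) • shiftLin e)ᴴ *ᵥ x) j = x j.succ - t * x j.castSucc := by
  simp only [Matrix.mulVec, dotProduct, shiftConst, shiftLin, Matrix.conjTranspose_apply,
    Matrix.add_apply, Matrix.smul_apply, Matrix.of_apply, smul_eq_mul, mul_ite, mul_neg, mul_one,
    mul_zero, star_add, add_mul, Finset.sum_add_distrib, apply_ite star, star_one, star_zero,
    star_neg, ite_mul, one_mul, zero_mul, Complex.star_def, Complex.conj_ofReal, neg_mul]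
  simp [sub_eq_add_neg]

theorem sum_shift_mulVec_eq_zero {e : ℕ} (t : ℝ) (y : Fin e → ℂ) :
    ∑ i : Fin (e + 1), (t : ℂ) ^ (i : ℕ) *
      ((shiftConst e + (t : ℂ) • shiftLin e) *ᵥ y) i = 0 := by
  set x : Fin (e + 1) → ℂ := fun i => (t : ℂ) ^ (i : ℕ) with hx
  have hstar : star x = x := by
    ext i
    simp [hx]
  have h : (shiftConst e + (t : ℂ) • shiftLin e)ᴴ *ᵥ x = 0 := by
    ext j
    rw [shift_conjTranspose_mulVec]
    simp [hx, pow_succ, mul_comm]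
  change x ⬝ᵥ _ = 0
  rw [Matrix.dotProduct_mulVec, ← hstar, ← Matrix.conjTranspose_conjTranspose
    (shiftConst e + (t : ℂ) • shiftLin e), ← Matrix.star_mulVec, h, star_zero, zero_dotProduct]

theorem sum_range_two_mul {f : ℕ → ℂ} (m : ℕ) :
    ∑ k ∈ Finset.range (2 * m), f k = ∑ i ∈ Finset.range m, (f (2 * i) + f (2 * i + 1)) := by
  induction m with
  | zero => simp
  | succ m ih =>
    rw [Finset.sum_range_succ, ← ih, Nat.mul_succ, Finset.sum_range_succ, Finset.sum_range_succ,
      add_assoc]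

/-- The even and odd coefficients of `q`, placed on the diagonals of the two coefficients of a
pencil, make its quadratic form at `(1, t, …, t ^ e)` equal to `q t`. -/
theorem sum_pow_mul_diagonal_pencil {e : ℕ} {q : Polynomial ℂ} (hq : q.natDegree ≤ 2 * e + 1)
    (t : ℂ) :
    ∑ i : Fin (e + 1), t ^ (i : ℕ) *
      (((Matrix.diagonal fun i : Fin (e + 1) => q.coeff (2 * i)) +
        t • Matrix.diagonal fun i : Fin (e + 1) => q.coeff (2 * i + 1)) *ᵥ
          fun i : Fin (e + 1) => t ^ (i : ℕ)) i = q.eval t := by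
  rw [Polynomial.eval_eq_sum_range' (n := 2 * (e + 1)) (by omega), sum_range_two_mul,
    Finset.sum_range]
  refine Finset.sum_congr rfl fun i _ => ?_
  rw [Matrix.add_mulVec, Matrix.smul_mulVec, Pi.add_apply, Pi.smul_apply, Matrix.mulVec_diagonal,
    Matrix.mulVec_diagonal, smul_eq_mul]
  ring

/-- The matrix whose first row is `star b` and whose other rows vanish. -/
def firstRow {μ : Type*} (e : ℕ) (b : μ → ℂ) : Matrix (Fin (e + 1)) μ ℂ :=
  Matrix.of fun i k => if i = 0 then star (b k) else 0

theorem firstRow_mulVec {μ : Type*} [Fintype μ] (e : ℕ) (b w : μ → ℂ) (i : Fin (e + 1)) :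
    (firstRow e b *ᵥ w) i = if i = 0 then star b ⬝ᵥ w else 0 := by
  by_cases h : i = 0 <;> simp [firstRow, Matrix.mulVec, dotProduct, h]

theorem firstRow_conjTranspose_mulVec {μ : Type*} (e : ℕ) (b : μ → ℂ) (x : Fin (e + 1) → ℂ) :
    (firstRow e b)ᴴ *ᵥ x = x 0 • b := by
  ext k
  simp only [Matrix.mulVec, dotProduct, Matrix.conjTranspose_apply, firstRow, Matrix.of_apply,
    Pi.smul_apply, smul_eq_mul]
  rw [Finset.sum_eq_single 0]
  · simp [mul_comm]
  · intro i _ hi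
    simp [hi]
  · simp

/-- Eliminating the rectangular blocks: at a nonzero real `t`, the Hermitian pencil assembled from
the diagonal pencil of `q`, the shift pencil, the vector `b` and the invertible matrix `R` is
singular exactly when the Schur complement `q t - bᴴ R⁻¹ b` vanishes. -/
theorem det_hermBlock_shift_eq_zero_iff {μ : Type*} [Fintype μ] [DecidableEq μ] {e : ℕ}
    {q : Polynomial ℂ} (hq : q.natDegree ≤ 2 * e + 1) {t : ℝ} (ht : t ≠ 0) {b : μ → ℂ}
    {R : Matrix μ μ ℂ} (hR : R.det ≠ 0) {y : μ → ℂ} (hy : R *ᵥ y = b) :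
    (hermBlock ((Matrix.diagonal fun i : Fin (e + 1) => q.coeff (2 * i)) +
        (t : ℂ) • Matrix.diagonal fun i : Fin (e + 1) => q.coeff (2 * i + 1))
      (shiftConst e + (t : ℂ) • shiftLin e) (firstRow e b) 0 0 R).det = 0 ↔
      q.eval (t : ℂ) = star b ⬝ᵥ y := by
  have ht' : (t : ℂ) ≠ 0 := by exact_mod_cast ht
  set E := (Matrix.diagonal fun i : Fin (e + 1) => q.coeff (2 * i)) +
        (t : ℂ) • Matrix.diagonal fun i : Fin (e + 1) => q.coeff (2 * i + 1) with hE
  set M := shiftConst e + (t : ℂ) • shiftLin e with hM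
  set v : Fin (e + 1) → ℂ := fun i => (t : ℂ) ^ (i : ℕ) with hv
  have hEv : ∑ i, v i * (E *ᵥ v) i = q.eval (t : ℂ) := sum_pow_mul_diagonal_pencil hq t
  have hfirst : ∀ w : μ → ℂ, ∑ i, v i * (firstRow e b *ᵥ w) i = star b ⬝ᵥ w := by
    intro w
    simp only [firstRow_mulVec]
    simp [hv]
  rw [← Matrix.exists_mulVec_eq_zero_iff]
  constructor
  · rintro ⟨u, hu0, hu⟩
    obtain ⟨x, z, w, rfl⟩ : ∃ x z w, u = Sum.elim x (Sum.elim z w) :=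
      ⟨u ∘ Sum.inl, u ∘ Sum.inr ∘ Sum.inl, u ∘ Sum.inr ∘ Sum.inr, by ext (i | i | i) <;> rfl⟩
    rw [hermBlock_mulVec] at hu
    have h1 : ∀ i, (E *ᵥ x) i + (M *ᵥ z) i + (firstRow e b *ᵥ w) i = 0 :=
      fun i => congrFun hu (Sum.inl i)
    have h2 : ∀ j, (Mᴴ *ᵥ x) j = 0 := fun j => congrFun hu (Sum.inr (Sum.inl j))
    have h3 : (firstRow e b)ᴴ *ᵥ x + R *ᵥ w = 0 :=
      funext fun k => congrFun hu (Sum.inr (Sum.inr k))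
    have hx : x = x 0 • v := by
      ext i
      induction i using Fin.induction with
      | zero => simp [hv]
      | succ j ih =>
        have := h2 j
        rw [shift_conjTranspose_mulVec, sub_eq_zero] at this
        rw [this, ih]
        simp only [Pi.smul_apply, smul_eq_mul, hv, Fin.val_castSucc, Fin.val_succ, pow_succ]
        ring
    have hRinj : Function.Injective R.mulVec :=
      Matrix.mulVec_injective_iff_isUnit.mpr
        ((Matrix.isUnit_iff_isUnit_det _).mpr (isUnit_iff_ne_zero.mpr hR))
    have hw : w = -(x 0 • y) := by
      apply hRinj
      rw [firstRow_conjTranspose_mulVec] at h3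
      rw [Matrix.mulVec_neg, Matrix.mulVec_smul, hy]
      exact eq_neg_of_add_eq_zero_right h3
    have hsum : x 0 * (q.eval (t : ℂ) - star b ⬝ᵥ y) = 0 := by
      have h4 : ∑ i, v i * ((E *ᵥ x) i + (M *ᵥ z) i + (firstRow e b *ᵥ w) i) = 0 :=
        Finset.sum_eq_zero fun i _ => by rw [h1 i, mul_zero]
      simp only [mul_add, Finset.sum_add_distrib] at h4
      have h5 : ∑ i, v i * (E *ᵥ x) i = x 0 * q.eval (t : ℂ) := by
        rw [← hEv, Finset.mul_sum]
        refine Finset.sum_congr rfl fun i _ => ?_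
        conv_lhs => rw [hx]
        rw [Matrix.mulVec_smul, Pi.smul_apply, smul_eq_mul]
        ring
      rw [h5, hfirst, sum_shift_mulVec_eq_zero, hw, dotProduct_neg, dotProduct_smul,
        smul_eq_mul] at h4
      linear_combination h4
    rcases mul_eq_zero.mp hsum with hx0 | h
    · -- With `x = 0` and `w = 0`, injectivity of the shift pencil forces `z = 0` too.
      exfalso
      apply hu0
      rw [hx0, zero_smul] at hx hw
      rw [neg_zero] at hw
      set Φ : ℕ → ℂ := fun k => if h : 0 < k ∧ k - 1 < e then z ⟨k - 1, h.2⟩ else 0 with hΦ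
      have hz : z = fun j : Fin e => Φ (j + 1) := by
        ext j
        simp [hΦ]
      have hrec : ∀ k ≤ e, Φ k = t * Φ (k + 1) := by
        intro k hk
        have h4 := h1 ⟨k, Nat.lt_succ_of_le hk⟩
        rw [hx, hw, Matrix.mulVec_zero, Matrix.mulVec_zero, hz,
          shift_mulVec (t : ℂ) (by simp [hΦ]) (by simp [hΦ])] at h4
        simp only [Pi.zero_apply, zero_add, add_zero] at h4
        exact sub_eq_zero.mp h4
      have hzero : ∀ k ≤ e, Φ k = 0 := by
        intro k
        induction k with
        | zero => intro _; simp [hΦ]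
        | succ k ih =>
          intro hk
          have h5 := hrec k (by omega)
          rw [ih (by omega)] at h5
          exact (mul_eq_zero.mp h5.symm).resolve_left ht'
      have hz0 : z = 0 := by
        rw [hz]
        ext j
        exact hzero _ j.2
      rw [hx, hz0, hw]
      ext (i | i | i) <;> rfl
    · exact sub_eq_zero.mp h
  · intro hroot
    set g : ℕ → ℂ := fun k => if h : k < e + 1 then
      -((E *ᵥ v) ⟨k, h⟩ + (firstRow e b *ᵥ (-y)) ⟨k, h⟩) else 0 with hg
    have hgi : ∀ i : Fin (e + 1), g i = -((E *ᵥ v) i + (firstRow e b *ᵥ (-y)) i) := by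
      intro i
      exact dif_pos i.2
    have hgsum : ∑ k ∈ Finset.range (e + 1), (t : ℂ) ^ k * g k = 0 := by
      rw [Finset.sum_range]
      have : ∀ i : Fin (e + 1), (t : ℂ) ^ (i : ℕ) * g i =
          -(v i * (E *ᵥ v) i + v i * (firstRow e b *ᵥ (-y)) i) := by
        intro i
        rw [hgi]
        ring
      rw [Finset.sum_congr rfl fun i _ => this i, Finset.sum_neg_distrib, Finset.sum_add_distrib,
        hEv, hfirst, hroot, dotProduct_neg]
      ring
    -- Solving the bidiagonal system `Φ k - t * Φ (k + 1) = g k`; it closes up by `hgsum`.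
    set Φ : ℕ → ℂ := fun k => -(((t : ℂ) ^ k)⁻¹ * ∑ m ∈ Finset.range k, (t : ℂ) ^ m * g m) with hΦ
    have hΦrec : ∀ k, Φ k - t * Φ (k + 1) = g k := by
      intro k
      simp only [hΦ, Finset.sum_range_succ]
      have := pow_ne_zero k ht'
      field_simp
      ring
    refine ⟨Sum.elim v (Sum.elim (fun j => Φ (j + 1)) (-y)), ?_, ?_⟩
    · intro h
      have := congrFun h (Sum.inl 0)
      simp [hv] at this
    · rw [hermBlock_mulVec]
      ext (i | j | k)
      · have h1 := shift_mulVec (t : ℂ) (e := e) (Φ := Φ) (by simp [hΦ])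
          (by simp only [hΦ, hgsum]; simp) i
        simp only [Sum.elim_inl, Pi.add_apply, Pi.zero_apply]
        rw [h1, hΦrec, hgi]
        ring
      · simp only [Sum.elim_inr, Sum.elim_inl, Pi.zero_apply]
        rw [shift_conjTranspose_mulVec]
        simp [hv, pow_succ, mul_comm]
      · simp only [Sum.elim_inr, Pi.zero_apply]
        rw [firstRow_conjTranspose_mulVec, Matrix.mulVec_neg, hy]
        simp [hv]

end SingularBlock

/-! ### Pencils in singular normal form are limits of diagonalizable pairs -/

section Closure

theorem IsSDCPair.congr {ι κ : Type*} [Fintype ι] [DecidableEq ι] [Fintype κ] [DecidableEq κ]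
    (e : ι ≃ κ) {X : Matrix κ κ ℂ × Matrix κ κ ℂ} (hX : IsSDCPair X) {Q : Matrix κ ι ℂ}
    {Q' : Matrix ι κ ℂ} (hQ : Q * Q' = 1) : IsSDCPair (Qᴴ * X.1 * Q, Qᴴ * X.2 * Q) := by
  obtain ⟨h1, h2, P, hP, hd1, hd2⟩ := hX
  have hconj : ∀ Y : Matrix κ κ ℂ, ((Q' * P).submatrix id e)ᴴ * (Qᴴ * Y * Q) *
      (Q' * P).submatrix id e = (Pᴴ * Y * P).submatrix e e := by
    intro Y
    have h3 : (Q' * P)ᴴ * (Qᴴ * Y * Q) * (Q' * P) = Pᴴ * Y * P := by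
      have h4 : Q'ᴴ * Qᴴ = 1 := by
        rw [← Matrix.conjTranspose_mul, hQ, Matrix.conjTranspose_one]
      calc (Q' * P)ᴴ * (Qᴴ * Y * Q) * (Q' * P)
          = Pᴴ * (Q'ᴴ * Qᴴ) * Y * (Q * Q') * P := by
            rw [Matrix.conjTranspose_mul]
            simp only [Matrix.mul_assoc]
        _ = Pᴴ * Y * P := by rw [h4, hQ, Matrix.mul_one, Matrix.mul_one]
    rw [← h3]
    ext i j
    simp [Matrix.mul_apply, Matrix.submatrix_apply]
  refine ⟨Matrix.isHermitian_conjTranspose_mul_mul _ h1,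
    Matrix.isHermitian_conjTranspose_mul_mul _ h2, (Q' * P).submatrix id e, ?_, ?_, ?_⟩
  · rw [Matrix.isUnit_iff_isUnit_det] at hP
    have h5 : (P⁻¹ * Q).submatrix e id * (Q' * P).submatrix id e = 1 := by
      have h6 : P⁻¹ * Q * (Q' * P) = 1 := by
        rw [Matrix.mul_assoc, ← Matrix.mul_assoc Q, hQ, Matrix.one_mul,
          Matrix.nonsing_inv_mul _ hP]
      rw [← Matrix.submatrix_mul _ _ e id e Function.bijective_id, h6,
        Matrix.submatrix_one_equiv]
    exact (Matrix.isUnit_iff_isUnit_det _).mpr (Matrix.isUnit_det_of_left_inverse h5)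
  · rw [hconj]
    exact hd1.submatrix e.injective
  · rw [hconj]
    exact hd2.submatrix e.injective

variable {μ : Type*} [Fintype μ] [DecidableEq μ]

/-- A pencil in singular normal form with generic regular part is a limit of diagonalizable pairs:
perturb the zero block by `s ^ 2 • E` and the coupling to the regular part by `s • a`. Rescaling
the blocks, the perturbed pencil is congruent to one that tends, as `s` tends to zero, to a pencil
free of `N` and `K` whose determinant is governed by the Schur complement `q - bᴴ R⁻¹ b`. -/
theorem hermBlock_mem_closure_of_isGenericPencil {e : ℕ} {N₀ N₁ : Matrix (Fin e) (Fin e) ℂ}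
    (hN₀ : N₀.IsHermitian) (hN₁ : N₁.IsHermitian) (K₀ K₁ : Matrix (Fin e) μ ℂ)
    {R₀ R₁ : Matrix μ μ ℂ} (hR : IsGenericPencil (R₀, R₁)) :
    (hermBlock 0 (shiftConst e) 0 N₀ K₀ R₀, hermBlock 0 (shiftLin e) 0 N₁ K₁ R₁) ∈
      closure {X | IsSDCPair X} := by
  obtain ⟨Z, b, q, hZ, hZ0, hq, hqreal, hZdet, hsol⟩ :=
    exists_real_rooted_schur_complement hR (N := Fintype.card μ + (2 * e + 1)) (by omega)
  have hq' : q.natDegree ≤ 2 * e + 1 := by omega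
  obtain ⟨hR₀, hR₁, hR₁det, l, hl, hldet⟩ := hR
  dsimp only at hR₀ hR₁ hR₁det hldet
  set E₀ := Matrix.diagonal fun i : Fin (e + 1) => q.coeff (2 * i) with hE₀
  set E₁ := Matrix.diagonal fun i : Fin (e + 1) => q.coeff (2 * i + 1) with hE₁
  have hE₀H : E₀.IsHermitian := by
    rw [hE₀, Matrix.IsHermitian, Matrix.diagonal_conjTranspose]
    congr 1
    ext i
    exact hqreal _
  have hE₁H : E₁.IsHermitian := by
    rw [hE₁, Matrix.IsHermitian, Matrix.diagonal_conjTranspose]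
    congr 1
    ext i
    exact hqreal _
  set L₀ := hermBlock E₀ (shiftConst e) (firstRow e b) 0 0 R₀ with hL₀
  set L₁ := hermBlock E₁ (shiftLin e) 0 0 0 R₁ with hL₁
  have hL : ∀ t : ℝ, L₀ + (t : ℂ) • L₁ = hermBlock (E₀ + (t : ℂ) • E₁)
      (shiftConst e + (t : ℂ) • shiftLin e) (firstRow e b) 0 0 (R₀ + (t : ℂ) • R₁) := by
    intro t
    rw [hL₀, hL₁, hermBlock_add_real_smul]
    simp only [smul_zero, add_zero]
  have hiff : ∀ t : ℝ, t ≠ 0 → (R₀ + (t : ℂ) • R₁).det ≠ 0 →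
      ((L₀ + (t : ℂ) • L₁).det = 0 ↔ t ∈ Z) := by
    intro t ht htR
    obtain ⟨y, hy, hyZ⟩ := hsol t htR
    rw [hL, det_hermBlock_shift_eq_zero_iff hq' ht htR hy, hyZ]
  obtain ⟨t₀, ht₀⟩ := Infinite.exists_notMem_finset
    (insert 0 (Z ∪ Finset.univ.image fun j => (l j).re))
  have ht₀R : (R₀ + (t₀ : ℂ) • R₁).det ≠ 0 := by
    rw [det_pencil_eq_mul_prod R₀ R₁ rfl hl hldet]
    refine mul_ne_zero hR₁det (Finset.prod_ne_zero_iff.mpr fun j _ h => ht₀ ?_)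
    simp only [Finset.mem_insert, Finset.mem_union, Finset.mem_image, Finset.mem_univ, true_and]
    exact Or.inr (Or.inr ⟨j, by rw [← sub_eq_zero.mp h, Complex.ofReal_re]⟩)
  have hev := eventually_isSDCPair (L := (L₀, L₁))
    (hermBlock_isHermitian hE₀H Matrix.isHermitian_zero hR₀ _ _ _)
    (hermBlock_isHermitian hE₁H Matrix.isHermitian_zero hR₁ _ _ _) Z
    (by simp [hZ]; ring)
    (fun z hz => (hiff z (fun h => hZ0 (h ▸ hz)) (hZdet z hz)).mpr hz) t₀
    (fun h => ht₀ (by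
      have := (hiff t₀ (fun h0 => ht₀ (by simp [h0])) ht₀R).mp h
      simp [this]))
  set Y : ℝ → Matrix _ _ ℂ × Matrix _ _ ℂ := fun s =>
    (hermBlock E₀ (shiftConst e) (firstRow e b) (((s ^ 2 : ℝ) : ℂ) • N₀) ((s : ℂ) • K₀) R₀,
      hermBlock E₁ (shiftLin e) 0 (((s ^ 2 : ℝ) : ℂ) • N₁) ((s : ℂ) • K₁) R₁) with hY
  set W : ℝ → Matrix _ _ ℂ × Matrix _ _ ℂ := fun s =>
    (hermBlock (((s ^ 2 : ℝ) : ℂ) • E₀) (shiftConst e) ((s : ℂ) • firstRow e b) N₀ K₀ R₀,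
      hermBlock (((s ^ 2 : ℝ) : ℂ) • E₁) (shiftLin e) ((s : ℂ) • 0) N₁ K₁ R₁) with hW
  have hYcont : Continuous Y := by
    refine Continuous.prodMk (continuous_hermBlock ?_ ?_ ?_ ?_ ?_ ?_)
      (continuous_hermBlock ?_ ?_ ?_ ?_ ?_ ?_) <;> fun_prop
  have hWcont : Continuous W := by
    refine Continuous.prodMk (continuous_hermBlock ?_ ?_ ?_ ?_ ?_ ?_)
      (continuous_hermBlock ?_ ?_ ?_ ?_ ?_ ?_) <;> fun_prop
  have hY0 : Y 0 = (L₀, L₁) := by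
    simp [hY, hL₀, hL₁]
  have hW0 : W 0 = (hermBlock 0 (shiftConst e) 0 N₀ K₀ R₀,
      hermBlock 0 (shiftLin e) 0 N₁ K₁ R₁) := by
    simp [hW]
  have hYev : ∀ᶠ s in 𝓝[≠] (0 : ℝ), IsSDCPair (Y s) := by
    have h1 : Tendsto Y (𝓝[≠] 0) (𝓝 (L₀, L₁)) := by
      rw [← hY0]
      exact hYcont.continuousAt.tendsto.mono_left nhdsWithin_le_nhds
    filter_upwards [h1.eventually hev] with s hs
    exact hs (hermBlock_isHermitian hE₀H (hN₀.real_smul _) hR₀ _ _ _)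
      (hermBlock_isHermitian hE₁H (hN₁.real_smul _) hR₁ _ _ _)
  have hWev : ∀ᶠ s in 𝓝[≠] (0 : ℝ), IsSDCPair (W s) := by
    filter_upwards [hYev, self_mem_nhdsWithin] with s hs hs0
    have hs0 : s ≠ 0 := hs0
    have hs0' : (s : ℂ) ≠ 0 := by exact_mod_cast hs0
    have hinv : blockScaling (α := Fin (e + 1)) (β := Fin e) (γ := μ) (s : ℂ) *
        blockScaling ((s : ℂ)⁻¹) = 1 := by
      rw [blockScaling, blockScaling, Matrix.diagonal_mul_diagonal, ← Matrix.diagonal_one]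
      congr 1
      ext (i | i | i) <;> simp [hs0']
    have := hs.congr (Equiv.refl _) hinv
    simp only [hY, blockScaling_congr _ _ _ _ _ _ hs0] at this
    exact this
  rw [← hW0]
  exact mem_closure_of_tendsto (hWcont.continuousAt.tendsto.mono_left nhdsWithin_le_nhds) hWev

theorem hermBlock_mem_closure {e : ℕ} {N₀ N₁ : Matrix (Fin e) (Fin e) ℂ}
    (hN₀ : N₀.IsHermitian) (hN₁ : N₁.IsHermitian) (K₀ K₁ : Matrix (Fin e) μ ℂ)
    {R₀ R₁ : Matrix μ μ ℂ} (hR₀ : R₀.IsHermitian) (hR₁ : R₁.IsHermitian) :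
    (hermBlock 0 (shiftConst e) 0 N₀ K₀ R₀, hermBlock 0 (shiftLin e) 0 N₁ K₁ R₁) ∈
      closure {X | IsSDCPair X} := by
  have hmem : (R₀, R₁) ∈ closure {S : Matrix μ μ ℂ × Matrix μ μ ℂ | IsGenericPencil S} := by
    rw [mem_closure_iff_nhds]
    intro U hU
    obtain ⟨S, hSU, hS⟩ := exists_isGenericPencil_mem_nhds hR₀ hR₁ hU
    exact ⟨S, hSU, hS⟩
  have hcont : Continuous fun S : Matrix μ μ ℂ × Matrix μ μ ℂ =>
      (hermBlock 0 (shiftConst e) 0 N₀ K₀ S.1, hermBlock 0 (shiftLin e) 0 N₁ K₁ S.2) := by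
    refine Continuous.prodMk (continuous_hermBlock ?_ ?_ ?_ ?_ ?_ ?_)
      (continuous_hermBlock ?_ ?_ ?_ ?_ ?_ ?_) <;> fun_prop
  have := map_mem_closure hcont hmem (t := closure {X | IsSDCPair X}) fun S hS =>
    hermBlock_mem_closure_of_isGenericPencil hN₀ hN₁ K₀ K₁ hS
  rwa [closure_closure] at this

end Closure

/-! ### The singular normal form -/

section NormalForm

variable {ι : Type*} [Fintype ι]

/-- The coefficients `v 0, …, v e` of a nonzero polynomial vector `∑ i, t ^ i • v i` annihilated by
the pencil `A + t • B`, extended by zero. -/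
def IsKernelChain (A B : Matrix ι ι ℂ) (e : ℕ) (v : ℕ → ι → ℂ) : Prop :=
  A *ᵥ v 0 = 0 ∧ (∀ i, A *ᵥ v (i + 1) = -(B *ᵥ v i)) ∧ (∀ i, e < i → v i = 0) ∧ ∃ i, v i ≠ 0

/-- If the pencil is singular on the real line, a vector over the polynomial ring lies in its
kernel. -/
theorem exists_isKernelChain [DecidableEq ι] {A B : Matrix ι ι ℂ}
    (h : ∀ t : ℝ, (A + (t : ℂ) • B).det = 0) : ∃ e v, IsKernelChain A B e v := by
  set P : Matrix ι ι (Polynomial ℂ) :=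
    (Polynomial.X : Polynomial ℂ) • B.map Polynomial.C + A.map Polynomial.C with hP
  have hdet : P.det = 0 := by
    refine Polynomial.eq_zero_of_infinite_isRoot _ ?_
    refine (Set.infinite_range_of_injective Complex.ofReal_injective).mono ?_
    rintro _ ⟨t, rfl⟩
    exact (eval_det_pencil A B t).trans (h t)
  obtain ⟨w, hw0, hw⟩ := Matrix.exists_mulVec_eq_zero_iff.mpr hdet
  have hcoeff : ∀ (D : Matrix ι ι ℂ) (i : ℕ) (k : ι),
      ((D.map Polynomial.C *ᵥ w) k).coeff i = (D *ᵥ fun k => (w k).coeff i) k := by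
    intro D i k
    simp [Matrix.mulVec, dotProduct, Polynomial.finsetSum_coeff]
  have hw' : ∀ k, (A.map Polynomial.C *ᵥ w) k + Polynomial.X * (B.map Polynomial.C *ᵥ w) k = 0 := by
    intro k
    have := congrFun hw k
    rwa [hP, add_comm, Matrix.add_mulVec, Matrix.smul_mulVec] at this
  refine ⟨Finset.univ.sup fun k => (w k).natDegree, fun i k => (w k).coeff i, ?_, ?_, ?_, ?_⟩
  · ext k
    rw [← hcoeff]
    have := congrArg (fun p => Polynomial.coeff p 0) (hw' k)
    simpa using this
  · intro i
    ext k
    rw [Pi.neg_apply, ← hcoeff, ← hcoeff]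
    have := congrArg (fun p => Polynomial.coeff p (i + 1)) (hw' k)
    simp only [Polynomial.coeff_add, Polynomial.coeff_X_mul, Polynomial.coeff_zero] at this
    exact eq_neg_of_add_eq_zero_left this
  · intro i hi
    ext k
    exact Polynomial.coeff_eq_zero_of_natDegree_lt
      (lt_of_le_of_lt (Finset.le_sup (f := fun k => (w k).natDegree) (Finset.mem_univ k)) hi)
  · by_contra! h0
    apply hw0
    ext k i
    exact congrFun (h0 i) k

/-- The span of a kernel chain is totally isotropic for `A`, because `(v i)ᴴ A (v j)` depends on
`i + j` only and vanishes for `i = 0`. -/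
theorem IsKernelChain.star_mulVec_dotProduct_eq_zero {A B : Matrix ι ι ℂ} (hA : A.IsHermitian)
    (hB : B.IsHermitian) {e : ℕ} {v : ℕ → ι → ℂ} (hv : IsKernelChain A B e v) (i j : ℕ) :
    star (A *ᵥ v i) ⬝ᵥ v j = 0 := by
  induction i generalizing j with
  | zero => rw [hv.1, star_zero, zero_dotProduct]
  | succ i ih =>
    rw [hv.2.1 i, star_neg, neg_dotProduct, hB.star_mulVec_dotProduct, ← dotProduct_neg,
      ← hv.2.1 j, ← hA.star_mulVec_dotProduct]
    exact ih (j + 1)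

section Minimal

variable {A B : Matrix ι ι ℂ} {e : ℕ} {v : ℕ → ι → ℂ}

theorem IsKernelChain.zero_ne_zero (hv : IsKernelChain A B e v)
    (hmin : ∀ e' v', IsKernelChain A B e' v' → e ≤ e') : v 0 ≠ 0 := by
  intro h0
  obtain ⟨-, h2, h3, i, hi⟩ := hv
  have hi0 : i ≠ 0 := by
    rintro rfl
    exact hi h0
  have hie : i ≤ e := by
    by_contra h
    exact hi (h3 i (by omega))
  have := hmin (e - 1) (fun k => v (k + 1))
    ⟨by rw [h2 0, h0, Matrix.mulVec_zero, neg_zero], fun k => h2 (k + 1),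
      fun k hk => h3 _ (by omega), i - 1, by
        dsimp only
        rwa [Nat.sub_add_cancel (by omega)]⟩
  omega

theorem IsKernelChain.last_ne_zero (hv : IsKernelChain A B e v)
    (hmin : ∀ e' v', IsKernelChain A B e' v' → e ≤ e') : v e ≠ 0 := by
  intro h0
  obtain ⟨h1, h2, h3, i, hi⟩ := hv
  have hie : i ≤ e := by
    by_contra h
    exact hi (h3 i (by omega))
  have hie' : i ≠ e := by
    rintro rfl
    exact hi h0
  have := hmin (e - 1) v ⟨h1, h2, fun k hk => by
    rcases eq_or_ne k e with rfl | hk'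
    · exact h0
    · exact h3 k (by omega), i, hi⟩
  omega

/-- A linear relation among the `A *ᵥ v (i + 1)` yields a shorter kernel chain, built from shifted
combinations of the `v i`. -/
theorem IsKernelChain.linearIndependent_mulVec (hv : IsKernelChain A B e v)
    (hmin : ∀ e' v', IsKernelChain A B e' v' → e ≤ e') :
    LinearIndependent ℂ fun i : Fin e => A *ᵥ v (i + 1) := by
  rw [Fintype.linearIndependent_iff]
  intro c hc
  by_contra! hne
  obtain ⟨i₀, hi₀, hlt⟩ : ∃ i₀, c i₀ ≠ 0 ∧ ∀ i < i₀, c i = 0 := by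
    classical
    obtain ⟨i₀, hi₀⟩ := Finset.exists_minimal (s := Finset.univ.filter fun i => c i ≠ 0)
      (by obtain ⟨i, hi⟩ := hne; exact ⟨i, by simp [hi]⟩)
    refine ⟨i₀, by simpa using hi₀.1, fun i hi => ?_⟩
    by_contra h
    exact absurd (hi₀.2 (by simp [h]) hi.le) (not_le.mpr hi)
  have hlast := hv.last_ne_zero hmin
  obtain ⟨h1, h2, h3, -⟩ := hv
  have hi₀e := i₀.2
  have := hmin (e - 1) (fun j => ∑ i : Fin e, c i • v (i + 1 + j)) ⟨?_, ?_, ?_, e - 1 - i₀, ?_⟩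
  · omega
  · rw [Matrix.mulVec_sum, ← hc]
    simp only [Matrix.mulVec_smul, add_zero]
  · intro j
    simp only [Matrix.mulVec_sum, Matrix.mulVec_smul, ← add_assoc, h2, smul_neg,
      Finset.sum_neg_distrib]
  · intro j hj
    refine Finset.sum_eq_zero fun i _ => ?_
    rw [h3 _ (by omega), smul_zero]
  · dsimp only
    rw [Finset.sum_eq_single i₀]
    · rw [show (i₀ : ℕ) + 1 + (e - 1 - i₀) = e by omega]
      exact smul_ne_zero hi₀ hlast
    · intro i _ hi
      rcases lt_or_gt_of_ne hi with hi | hi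
      · rw [hlt i hi, zero_smul]
      · have : (i₀ : ℕ) < i := hi
        rw [h3 _ (by omega), smul_zero]
    · simp

theorem IsKernelChain.linearIndependent (hv : IsKernelChain A B e v)
    (hmin : ∀ e' v', IsKernelChain A B e' v' → e ≤ e') :
    LinearIndependent ℂ fun i : Fin (e + 1) => v i := by
  rw [Fintype.linearIndependent_iff]
  intro c hc
  rw [Fin.sum_univ_succ] at hc
  have hsucc : ∀ i : Fin e, c i.succ = 0 := by
    refine Fintype.linearIndependent_iff.mp (hv.linearIndependent_mulVec hmin)
      (fun i => c i.succ) ?_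
    have := congrArg (fun x => A *ᵥ x) hc
    simpa [Matrix.mulVec_add, Matrix.mulVec_sum, Matrix.mulVec_smul, hv.1] using this
  have h0 : c 0 = 0 := by
    simp only [hsucc, zero_smul, Finset.sum_const_zero, add_zero] at hc
    exact (smul_eq_zero.mp hc).resolve_right (hv.zero_ne_zero hmin)
  exact fun i => Fin.cases h0 hsucc i

end Minimal

theorem exists_linearIndependent_sum_elim {V : Type*} [AddCommGroup V] [Module ℂ V]
    [FiniteDimensional ℂ V] {κ : Type*} [Fintype κ] {v : κ → V} (hv : LinearIndependent ℂ v) :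
    ∃ (m : ℕ) (z : Fin m → V), LinearIndependent ℂ (Sum.elim v z) ∧
      Fintype.card κ + m = Module.finrank ℂ V := by
  obtain ⟨C, hC⟩ := Submodule.exists_isCompl (Submodule.span ℂ (Set.range v))
  refine ⟨Module.finrank ℂ C, fun i => Module.finBasis ℂ C i, ?_, ?_⟩
  · refine hv.sum_type ((Module.finBasis ℂ C).linearIndependent.map' C.subtype (by simp)) ?_
    refine hC.disjoint.mono_right (Submodule.span_le.mpr ?_)
    rintro _ ⟨i, rfl⟩
    exact (Module.finBasis ℂ C i).2
  · rw [← Submodule.finrank_add_eq_of_isCompl hC, finrank_span_eq_card hv]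

open scoped ComplexOrder in
theorem rank_map_star {κ : Type*} [Fintype κ] (V : Matrix κ ι ℂ) :
    (V.map star).rank = V.rank := by
  rw [show V.map star = Vᵀᴴ from rfl, Matrix.rank_conjTranspose, Matrix.rank_transpose]

/-- A singular Hermitian pencil is congruent to a block pencil whose upper left block vanishes and
whose upper middle block is the shift pencil. The basis consists of a minimal kernel chain `v`,
vectors dual to the `A *ᵥ v (i + 1)`, and a completion inside the annihilator of the
`A *ᵥ v (i + 1)`. -/
theorem exists_singular_normal_form [DecidableEq ι] {A B : Matrix ι ι ℂ} (hA : A.IsHermitian)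
    (hB : B.IsHermitian) (h : ∀ t : ℝ, (A + (t : ℂ) • B).det = 0) :
    ∃ (e m : ℕ) (_ : ι ≃ Fin (e + 1) ⊕ (Fin e ⊕ Fin m))
      (P : Matrix ι (Fin (e + 1) ⊕ (Fin e ⊕ Fin m)) ℂ)
      (Q : Matrix (Fin (e + 1) ⊕ (Fin e ⊕ Fin m)) ι ℂ)
      (N₀ N₁ : Matrix (Fin e) (Fin e) ℂ) (K₀ K₁ : Matrix (Fin e) (Fin m) ℂ)
      (R₀ R₁ : Matrix (Fin m) (Fin m) ℂ), P * Q = 1 ∧ Q * P = 1 ∧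
      N₀.IsHermitian ∧ N₁.IsHermitian ∧ R₀.IsHermitian ∧ R₁.IsHermitian ∧
      Pᴴ * A * P = hermBlock 0 (shiftConst e) 0 N₀ K₀ R₀ ∧
      Pᴴ * B * P = hermBlock 0 (shiftLin e) 0 N₁ K₁ R₁ := by
  classical
  have hex := exists_isKernelChain h
  set e := Nat.find hex with he
  obtain ⟨v, hv⟩ := Nat.find_spec hex
  have hmin : ∀ e' v', IsKernelChain A B e' v' → e ≤ e' :=
    fun e' v' hv' => Nat.find_min' hex ⟨v', hv'⟩
  rw [← he] at hv
  clear_value e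
  have hviso := hv.star_mulVec_dotProduct_eq_zero hA hB
  have hvli := hv.linearIndependent hmin
  set V : Matrix (Fin e) ι ℂ := Matrix.of fun i => A *ᵥ v (i + 1) with hV
  have hVrank : (V.map star).rank = e := by
    have h1 : V.rank = e := by
      simpa using (hv.linearIndependent_mulVec hmin).rank_matrix (M := V)
    exact (rank_map_star V).trans h1
  set ℓ : (ι → ℂ) →ₗ[ℂ] (Fin e → ℂ) := (V.map star).mulVecLin with hℓ
  have hℓapp : ∀ x i, ℓ x i = star (A *ᵥ v (i + 1)) ⬝ᵥ x := fun x i => rfl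
  have hrange : Module.finrank ℂ (LinearMap.range ℓ) = e := hVrank
  have hsurj : Function.Surjective ℓ := by
    rw [← LinearMap.range_eq_top]
    exact Submodule.eq_top_of_finrank_eq (by simp [hrange])
  have hvker : ∀ i : ℕ, v i ∈ LinearMap.ker ℓ := by
    intro i
    rw [LinearMap.mem_ker]
    ext j
    exact hviso _ _
  have hvKli : LinearIndependent ℂ fun i : Fin (e + 1) => (⟨v i, hvker i⟩ : LinearMap.ker ℓ) :=
    LinearIndependent.of_comp (LinearMap.ker ℓ).subtype hvli
  obtain ⟨m, z, hz, hm⟩ := exists_linearIndependent_sum_elim hvKli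
  choose y hy using fun j : Fin e => hsurj (Pi.single j 1)
  have hcard : Fintype.card ι = Fintype.card (Fin (e + 1) ⊕ (Fin e ⊕ Fin m)) := by
    have h1 := LinearMap.finrank_range_add_finrank_ker ℓ
    rw [hrange, ← hm, Module.finrank_fintype_fun_eq_card] at h1
    simp only [Fintype.card_sum, Fintype.card_fin] at h1 ⊢
    omega
  set p : Fin (e + 1) ⊕ (Fin e ⊕ Fin m) → ι → ℂ :=
    Sum.elim (fun i => v i) (Sum.elim y fun k => (z k : ι → ℂ)) with hp
  have hpli : LinearIndependent ℂ p := by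
    rw [Fintype.linearIndependent_iff]
    intro g hg
    simp only [Fintype.sum_sum_type, hp, Sum.elim_inl, Sum.elim_inr] at hg
    have hgy : ∀ j, g (Sum.inr (Sum.inl j)) = 0 := by
      intro j
      have h1 := congrFun (congrArg ℓ hg) j
      simp only [map_add, map_sum, map_smul, hy, LinearMap.mem_ker.mp (hvker _),
        LinearMap.mem_ker.mp (z _).2, smul_zero, Finset.sum_const_zero, zero_add, add_zero,
        map_zero, Finset.sum_apply, Pi.smul_apply, smul_eq_mul, Pi.zero_apply] at h1
      simpa [Pi.single_apply] using h1
    have hgK : ∀ k : Fin (e + 1) ⊕ Fin m, Sum.elim (fun i => g (Sum.inl i))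
        (fun k => g (Sum.inr (Sum.inr k))) k = 0 := by
      refine Fintype.linearIndependent_iff.mp hz _ ?_
      apply Subtype.ext
      simp only [hgy, zero_smul, Finset.sum_const_zero, zero_add] at hg
      simpa [Fintype.sum_sum_type] using hg
    rintro (i | j | k)
    · exact hgK (Sum.inl i)
    · exact hgy j
    · exact hgK (Sum.inr k)
  set eq : ι ≃ Fin (e + 1) ⊕ (Fin e ⊕ Fin m) := Fintype.equivOfCardEq hcard
  set P : Matrix ι (Fin (e + 1) ⊕ (Fin e ⊕ Fin m)) ℂ := Matrix.of fun k i => p i k with hP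
  obtain ⟨Q, hQP⟩ : ∃ Q : Matrix (Fin (e + 1) ⊕ (Fin e ⊕ Fin m)) ι ℂ, Q * P = 1 := by
    have h1 : IsUnit (P.submatrix id eq) := by
      rw [← Matrix.linearIndependent_cols_iff_isUnit]
      exact hpli.comp eq eq.injective
    obtain ⟨D, hD⟩ := h1.exists_left_inv
    refine ⟨D.submatrix eq.symm id, ?_⟩
    have h2 : (D * P.submatrix id eq).submatrix eq.symm eq.symm = 1 := by
      rw [hD, Matrix.submatrix_one_equiv]
    rw [← h2]
    ext i j
    simp [Matrix.mul_apply]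
  have hPQ : P * Q = 1 := (Matrix.mul_eq_one_comm_of_equiv eq.symm).mp hQP
  have hXA : (Pᴴ * A * P).IsHermitian := Matrix.isHermitian_conjTranspose_mul_mul _ hA
  have hXB : (Pᴴ * B * P).IsHermitian := Matrix.isHermitian_conjTranspose_mul_mul _ hB
  have hAapp : ∀ (i : Fin (e + 1)) k,
      (Pᴴ * A * P) (Sum.inl i) k = star (A *ᵥ v i) ⬝ᵥ p k := by
    intro i k
    rw [conjTranspose_mul_mul_apply, ← hA.star_mulVec_dotProduct]
    rfl
  have hBapp : ∀ (i : Fin (e + 1)) k,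
      (Pᴴ * B * P) (Sum.inl i) k = -(star (A *ᵥ v (i + 1)) ⬝ᵥ p k) := by
    intro i k
    rw [conjTranspose_mul_mul_apply, ← hB.star_mulVec_dotProduct, hv.2.1, star_neg,
      neg_dotProduct, neg_neg]
    rfl
  have hyapp : ∀ (i j : Fin e), star (A *ᵥ v (i + 1)) ⬝ᵥ y j = if i = j then 1 else 0 := by
    intro i j
    rw [← hℓapp, hy, Pi.single_apply]
  have hzapp : ∀ (i : ℕ) (k : Fin m), star (A *ᵥ v i) ⬝ᵥ (z k : ι → ℂ) = 0 := by
    intro i k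
    rcases i with - | i
    · rw [hv.1, star_zero, zero_dotProduct]
    · by_cases hi : i < e
      · have h1 := congrFun (LinearMap.mem_ker.mp (z k).2) ⟨i, hi⟩
        exact h1
      · rw [hv.2.2.1 (i + 1) (by omega), Matrix.mulVec_zero, star_zero, zero_dotProduct]
  refine ⟨e, m, eq, P, Q, _, _, _, _, _, _, hPQ, hQP, hXA.submatrix _, hXB.submatrix _,
    hXA.submatrix _, hXB.submatrix _, hXA.eq_hermBlock ?_ ?_ ?_, hXB.eq_hermBlock ?_ ?_ ?_⟩
  · exact fun i j => (hAapp _ _).trans (hviso _ _)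
  · intro i j
    rw [hAapp]
    refine Fin.cases ?_ (fun i => ?_) i
    · simp [hv.1, shiftConst, (Fin.succ_ne_zero _).symm]
    · refine (hyapp i j).trans ?_
      simp [shiftConst, Fin.succ_inj]
  · exact fun i j => (hAapp _ _).trans (hzapp _ _)
  · intro i j
    rw [hBapp]
    simp only [hp, Sum.elim_inl, hviso, neg_zero, Matrix.zero_apply]
  · intro i j
    rw [hBapp]
    refine Fin.lastCases ?_ (fun i => ?_) i
    · rw [Fin.val_last, hv.2.2.1 (e + 1) (by omega), Matrix.mulVec_zero, star_zero,
        zero_dotProduct, neg_zero]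
      exact (if_neg (Fin.castSucc_lt_last j).ne').symm
    · refine (congrArg Neg.neg (hyapp i j)).trans ?_
      simp only [shiftLin, Matrix.of_apply, Fin.castSucc_inj]
      split_ifs <;> simp
  · intro i j
    rw [hBapp]
    simp only [hp, Sum.elim_inr, hzapp, neg_zero, Matrix.zero_apply]

end NormalForm

/-! ### Singular pairs -/

theorem singular_pencil_mem_closure {ι : Type*} [Fintype ι] [DecidableEq ι] {A B : Matrix ι ι ℂ}
    (hA : A.IsHermitian) (hB : B.IsHermitian) (h : ∀ t : ℝ, (A + (t : ℂ) • B).det = 0) :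
    (A, B) ∈ closure {X | IsSDCPair X} := by
  obtain ⟨e, m, eq, P, Q, N₀, N₁, K₀, K₁, R₀, R₁, hPQ, hQP, hN₀, hN₁, hR₀, hR₁, hPA, hPB⟩ :=
    exists_singular_normal_form hA hB h
  have hback : ∀ D : Matrix ι ι ℂ, Qᴴ * (Pᴴ * D * P) * Q = D := by
    intro D
    have h1 : Qᴴ * Pᴴ = 1 := by
      rw [← Matrix.conjTranspose_mul, hPQ, Matrix.conjTranspose_one]
    calc Qᴴ * (Pᴴ * D * P) * Q = (Qᴴ * Pᴴ) * D * (P * Q) := by simp only [Matrix.mul_assoc]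
      _ = D := by rw [h1, hPQ, Matrix.one_mul, Matrix.mul_one]
  have hcongr : Continuous fun D : Matrix (Fin (e + 1) ⊕ (Fin e ⊕ Fin m))
      (Fin (e + 1) ⊕ (Fin e ⊕ Fin m)) ℂ =>
      (Qᴴ * D * Q : Matrix ι ι ℂ) := by
    fun_prop
  have hcont := (hcongr.comp continuous_fst).prodMk (hcongr.comp continuous_snd)
  have := map_mem_closure hcont (hermBlock_mem_closure hN₀ hN₁ K₀ K₁ hR₀ hR₁)
    (t := {X | IsSDCPair X}) fun X hX => IsSDCPair.congr eq hX hQP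
  rw [← hPA, ← hPB] at this
  simp only [Function.comp_apply] at this
  rw [hback A, hback B] at this
  exact this

theorem mainTheorem1 {n : ℕ} (A B : HermMat n)
    (hAB : IsSingularSet ({A, B} : Set (HermMat n))) :
    IsASDC ({A, B} : Set (HermMat n)) := by
  classical
  have hdet : ∀ t : ℝ, ((A : Matrix (Fin n) (Fin n) ℂ) + (t : ℂ) • (B : Matrix _ _ ℂ)).det = 0 := by
    intro t
    by_contra h
    refine hAB ⟨A + t • B, ?_, ?_⟩
    · exact Submodule.add_mem _ (Submodule.subset_span (by simp))
        (Submodule.smul_mem _ _ (Submodule.subset_span (by simp)))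
    · rw [Matrix.isUnit_iff_isUnit_det, isUnit_iff_ne_zero]
      exact h
  have : FirstCountableTopology (Matrix (Fin n) (Fin n) ℂ) :=
    inferInstanceAs (FirstCountableTopology (Fin n → Fin n → ℂ))
  obtain ⟨X, hX, hlim⟩ := mem_closure_iff_seq_limit.mp (singular_pencil_mem_closure A.2 B.2 hdet)
  rw [Prod.tendsto_iff] at hlim
  refine ⟨fun p => if p.1.1 = A then ⟨(X p.2).1, (hX p.2).1⟩ else ⟨(X p.2).2, (hX p.2).2.1⟩,
    ?_, fun j => ?_⟩
  · rintro ⟨M, hM⟩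
    rw [tendsto_subtype_rng]
    by_cases hMA : M = A
    · subst hMA
      simpa using hlim.1
    · obtain rfl : M = B := by simpa [hMA] using hM
      simpa [hMA] using hlim.2
  · obtain ⟨-, -, P, hP, h1, h2⟩ := hX j
    refine ⟨P, hP, ?_⟩
    rintro _ ⟨M, rfl⟩
    dsimp only
    split_ifs
    · exact h1
    · exact h2
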